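/- Let $\mathbb F$ be a field. A Lie triple system over $\mathbb F$ is an $\mathbb F$-vector space $\mathcal T$ with a trilinear map $[\cdot,\cdot,\cdot]:\mathcal T^3\to\mathcal T$ such that, for all $x,y,z,u,v\in\mathcal T$, $$[x,y,z]+[y,x,z]=0,\qquad [x,y,z]+[y,z,x]+[z,x,y]=0,$$ $$[u,v,[x,y,z]]=[[u,v,x],y,z]+[x,[u,v,y],z]+[x,y,[u,v,z]].$$ An isomorphism is a linear bijection preserving the bracket. $\mathcal T$ is nilpotent if $\mathcal T^{(m)}=0$ for some $m\ge 0$, where $\mathcal T^{(0)}=\mathcal T$ and $\mathcal T^{(n+1)}=[\mathcal T^{(n)},\mathcal T,\mathcal T]+[\mathcal T,\mathcal T,\mathcal T^{(n)}]$ (linear spans of products). Suppose now that $\mathbb F$ is algebraically closed of characteristic different from $2$ and $3$. Consider the following triple systems on $\mathbb F^4$ with basis $e_1,e_2,e_3,e_4$, where all products of basis vectors are zero except the listed ones and those obtained from them by $[x,y,z]=-[y,x,z]$: - $\mathcal T_{4,1}$: all products zero (abelian). - $\mathcal T_{4,2}$: $[e_1,e_2,e_1]=e_3$. - $\mathcal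 T_{4,3}$: $[e_1,e_2,e_1]=e_3$, $[e_1,e_2,e_2]=e_4$. - $\mathcal T_{4,4}$: $[e_2,e_3,e_2]=e_4$, $[e_3,e_1,e_3]=e_4$. - $\mathcal T_{4,5}$: $[e_2,e_3,e_1]=e_4$, $[e_3,e_1,e_2]=e_4$, $[e_2,e_1,e_3]=2e_4$, $[e_2,e_3,e_2]=e_4$. - $\mathcal T_{4,6}^{\lambda}$ ($\lambda\in\mathbb F$): $[e_1,e_2,e_3]=-(\lambda+1)e_4$, $[e_2,e_3,e_1]=\lambda e_4$, $[e_3,e_1,e_2]=e_4$. - $\mathcal T_{4,7}$: $[e_1,e_2,e_1]=e_3$, $[e_1,e_2,e_3]=e_4$, $[e_1,e_3,e_2]=e_4$. - $\mathcal T_{4,8}$: $[e_1,e_2,e_1]=e_3$, $[e_1,e_3,e_1]=e_4$, $[e_1,e_2,e_2]=e_4$. - $\mathcal T_{4,9}$: $[e_1,e_2,e_1]=e_3$, $[e_1,e_3,e_1]=e_4$. All of these are nilpotent Lie triple systems, and every $4$-dimensional nilpotent Lie triple system over $\mathbb F$ is isomorphic to one of them. The only isomorphisms between distinct members of this list are the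 following: $\mathcal T_{4,6}^{0}\cong\mathcal T_{4,6}^{-1}$; and, for $\alpha,\beta\in\mathbb F$ with $\alpha^2+\alpha\ne0$ and $\beta^2+\beta\neq 0$, $\mathcal T_{4,6}^{\alpha}\cong\mathcal T_{4,6}^{\beta}$ if and only if $\xi(\alpha)=\xi(\beta)$, where $$\xi(\lambda)=\frac{(\lambda^2+\lambda+1)^3}{\lambda^2(\lambda+1)^2}.$$ -/

import Mathlib

/-- A Lie triple system structure on the vector space `T`: a trilinear bracket `[x, y, z]` that is
skew-symmetric in the first two arguments, satisfies the ternary Jacobi identity, and for which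
every `[u, v, ·]` is a derivation. -/
structure LieTripleSystem (F T : Type*) [Field F] [AddCommGroup T] [Module F T] where
  bracket : T →ₗ[F] T →ₗ[F] T →ₗ[F] T
  skew : ∀ x y z, bracket x y z + bracket y x z = 0
  cyclic : ∀ x y z, bracket x y z + bracket y z x + bracket z x y = 0
  derivation : ∀ u v x y z, bracket u v (bracket x y z) =
    bracket (bracket u v x) y z + bracket x (bracket u v y) z + bracket x y (bracket u v z)

namespace LieTripleSystem

section General

variable {F T T' : Type*} [Field F] [AddCommGroup T] [Module F T] [AddCommGroup T'] [Module F T']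

/-- `[A, B, C]`: the linear span of all products `[a, b, c]` with `a ∈ A`, `b ∈ B`, `c ∈ C`. -/
def bracketSpan (S : LieTripleSystem F T) (A B C : Submodule F T) : Submodule F T :=
  Submodule.span F {w | ∃ a ∈ A, ∃ b ∈ B, ∃ c ∈ C, S.bracket a b c = w}

/-- The sequence `I⁽⁰⁾ = I`, `I⁽ⁿ⁺¹⁾ = [I⁽ⁿ⁾, T, I] + [I, T, I⁽ⁿ⁾]`. -/
def series (S : LieTripleSystem F T) (I : Submodule F T) : ℕ → Submodule F T
  | 0 => I
  | n + 1 => S.bracketSpan (S.series I n) ⊤ I ⊔ S.bracketSpan I ⊤ (S.series I n)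

/-- A Lie triple system `T` is nilpotent if `T⁽ᵐ⁾ = 0` for some `m`. -/
def IsNilpotent (S : LieTripleSystem F T) : Prop :=
  ∃ m : ℕ, S.series ⊤ m = ⊥

/-- Two Lie triple systems are isomorphic if some linear bijection preserves the bracket. -/
def Isomorphic (S : LieTripleSystem F T) (S' : LieTripleSystem F T') : Prop :=
  ∃ φ : T ≃ₗ[F] T', ∀ x y z, φ (S.bracket x y z) = S'.bracket (φ x) (φ y) (φ z)

end General

section Tables

variable (F : Type*) [Field F]

/-- The trilinear map on `F⁴` with `[e_i, e_j, e_k] = e_l`, `[e_j, e_i, e_k] = -e_l` (for `i ≠ j`)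
and all other products of the standard basis vectors zero. -/
def elem (i j k l : Fin 4) :
    (Fin 4 → F) →ₗ[F] (Fin 4 → F) →ₗ[F] (Fin 4 → F) →ₗ[F] (Fin 4 → F) :=
  LinearMap.mk₂ F
    (fun x y => (x i * y j - x j * y i) •
      (LinearMap.proj k : (Fin 4 → F) →ₗ[F] F).smulRight (Pi.single l (1 : F)))
    (fun x x' y => by rw [← add_smul]; congr 1; simp only [Pi.add_apply]; ring)
    (fun c x y => by rw [smul_smul]; congr 1; simp only [Pi.smul_apply, smul_eq_mul]; ring)
    (fun x y y' => by rw [← add_smul]; congr 1; simp only [Pi.add_apply]; ring)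
    (fun c x y => by rw [smul_smul]; congr 1; simp only [Pi.smul_apply, smul_eq_mul]; ring)

theorem elem_apply (i j k l : Fin 4) (x y z : Fin 4 → F) :
    elem F i j k l x y z = ((x i * y j - x j * y i) * z k) • Pi.single l (1 : F) := by
  simp [elem, smul_smul]

/-! The standard basis `e₁, e₂, e₃, e₄` of `F⁴` is indexed by `0, 1, 2, 3 : Fin 4`, so that
`elem F 0 1 0 2` stands for `[e₁, e₂, e₁] = e₃`. Products of basis vectors that are neither
listed nor obtained from a listed one by exchanging the first two arguments are zero. -/

/-- The abelian Lie triple system of dimension four. -/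
def T41 : LieTripleSystem F (Fin 4 → F) where
  bracket := 0
  skew x y z := by simp
  cyclic x y z := by simp
  derivation u v x y z := by simp

/-- `[e₁, e₂, e₁] = e₃`. -/
def T42 : LieTripleSystem F (Fin 4 → F) where
  bracket := elem F 0 1 0 2
  skew x y z := by ext t; fin_cases t <;> simp [elem_apply]; ring
  cyclic x y z := by ext t; fin_cases t <;> simp [elem_apply]; ring
  derivation u v x y z := by ext t; fin_cases t <;> simp [elem_apply]

/-- `[e₁, e₂, e₁] = e₃`, `[e₁, e₂, e₂] = e₄`. -/
def T43 : LieTripleSystem F (Fin 4 → F) where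
  bracket := elem F 0 1 0 2 + elem F 0 1 1 3
  skew x y z := by ext t; fin_cases t <;> simp [elem_apply] <;> ring
  cyclic x y z := by ext t; fin_cases t <;> simp [elem_apply] <;> ring
  derivation u v x y z := by ext t; fin_cases t <;> simp [elem_apply]

/-- `[e₂, e₃, e₂] = e₄`, `[e₃, e₁, e₃] = e₄`. -/
def T44 : LieTripleSystem F (Fin 4 → F) where
  bracket := elem F 1 2 1 3 + elem F 2 0 2 3
  skew x y z := by ext t; fin_cases t <;> simp [elem_apply] <;> ring
  cyclic x y z := by ext t; fin_cases t <;> simp [elem_apply] <;> ring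
  derivation u v x y z := by ext t; fin_cases t <;> simp [elem_apply]

/-- `[e₂, e₃, e₁] = e₄`, `[e₃, e₁, e₂] = e₄`, `[e₂, e₁, e₃] = 2 e₄`, `[e₂, e₃, e₂] = e₄`. -/
def T45 : LieTripleSystem F (Fin 4 → F) where
  bracket := elem F 1 2 0 3 + elem F 2 0 1 3 + (2 : F) • elem F 1 0 2 3 + elem F 1 2 1 3
  skew x y z := by ext t; fin_cases t <;> simp [elem_apply] <;> ring
  cyclic x y z := by ext t; fin_cases t <;> simp [elem_apply] <;> ring
  derivation u v x y z := by ext t; fin_cases t <;> simp [elem_apply]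

/-- `[e₁, e₂, e₃] = -(a + 1) e₄`, `[e₂, e₃, e₁] = a e₄`, `[e₃, e₁, e₂] = e₄`. -/
def T46 (a : F) : LieTripleSystem F (Fin 4 → F) where
  bracket := (-(a + 1)) • elem F 0 1 2 3 + a • elem F 1 2 0 3 + elem F 2 0 1 3
  skew x y z := by ext t; fin_cases t <;> simp [elem_apply] <;> ring
  cyclic x y z := by ext t; fin_cases t <;> simp [elem_apply] <;> ring
  derivation u v x y z := by ext t; fin_cases t <;> simp [elem_apply]

/-- `[e₁, e₂, e₁] = e₃`, `[e₁, e₂, e₃] = e₄`, `[e₁, e₃, e₂] = e₄`. -/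
def T47 : LieTripleSystem F (Fin 4 → F) where
  bracket := elem F 0 1 0 2 + elem F 0 1 2 3 + elem F 0 2 1 3
  skew x y z := by ext t; fin_cases t <;> simp [elem_apply] <;> ring
  cyclic x y z := by ext t; fin_cases t <;> simp [elem_apply] <;> ring
  derivation u v x y z := by ext t; fin_cases t <;> simp [elem_apply] <;> ring

/-- `[e₁, e₂, e₁] = e₃`, `[e₁, e₃, e₁] = e₄`, `[e₁, e₂, e₂] = e₄`. -/
def T48 : LieTripleSystem F (Fin 4 → F) where
  bracket := elem F 0 1 0 2 + elem F 0 2 0 3 + elem F 0 1 1 3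
  skew x y z := by ext t; fin_cases t <;> simp [elem_apply] <;> ring
  cyclic x y z := by ext t; fin_cases t <;> simp [elem_apply] <;> ring
  derivation u v x y z := by ext t; fin_cases t <;> simp [elem_apply] <;> ring

/-- `[e₁, e₂, e₁] = e₃`, `[e₁, e₃, e₁] = e₄`. -/
def T49 : LieTripleSystem F (Fin 4 → F) where
  bracket := elem F 0 1 0 2 + elem F 0 2 0 3
  skew x y z := by ext t; fin_cases t <;> simp [elem_apply] <;> ring
  cyclic x y z := by ext t; fin_cases t <;> simp [elem_apply] <;> ring
  derivation u v x y z := by ext t; fin_cases t <;> simp [elem_apply] <;> ring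

/-- The names in the list of four-dimensional systems; `t6 a` names the member with parameter `a`
of the one-parameter family. -/
inductive Label where
  | t1 | t2 | t3 | t4 | t5
  | t6 (a : F)
  | t7 | t8 | t9

variable {F}

/-- The Lie triple system with a given name. -/
def Label.system : Label F → LieTripleSystem F (Fin 4 → F)
  | .t1 => T41 F
  | .t2 => T42 F
  | .t3 => T43 F
  | .t4 => T44 F
  | .t5 => T45 F
  | .t6 a => T46 F a
  | .t7 => T47 F
  | .t8 => T48 F
  | .t9 => T49 F

/-- `ξ(a) = (a² + a + 1)³ / (a² (a + 1)²)`, meaningful for `a² + a ≠ 0`. -/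
def xi (a : F) : F :=
  (a ^ 2 + a + 1) ^ 3 / (a ^ 2 * (a + 1) ^ 2)

end Tables

end LieTripleSystem

/-!
Nilpotency yields a basis `b₀, b₁, b₂, b₃` in which every product involving `bᵢ` lies in the span
of the later basis vectors; in particular `b₃` is central. If `[b₀, b₁, ·]` maps `b₀` and `b₁` into
the line of `b₃`, then every product lies on that line, and the bracket is `det(x, y, A z) b₃` for
a `3 × 3` matrix `A` on the quotient by `b₃`; the ternary Jacobi identity says `tr A = 0`. Such
systems are isomorphic exactly when their matrices are similar up to a nonzero scalar, so the Jordan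
form of `A` gives `T41`, `T42`, `T44`, `T45` and `T46`. Otherwise a change of basis makes
`[e₁, e₂, e₁] = e₃` and leaves three structure constants, which rescale to `T42`, `T43`, `T47`,
`T48` or `T49`.

An isomorphism between members of the family `T46` scales the spectrum `{a, 1, -(a + 1)}` by some
`c ≠ 0`, so the elementary symmetric functions `-(a² + a + 1)` and `-(a² + a)` scale by `c²` and
`c³`, and `ξ` is preserved. Conversely, `ξ(a) = ξ(b)` factors into six conditions on `(a, b)`,
one for each permutation of the spectrum.
-/

open Matrix Module

namespace LieTripleSystem

section Basic

variable {F T T' T'' : Type*} [Field F] [AddCommGroup T] [Module F T] [AddCommGroup T']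
  [Module F T'] [AddCommGroup T''] [Module F T'']

@[ext]
theorem ext {S S' : LieTripleSystem F T} (h : S.bracket = S'.bracket) : S = S' := by
  cases S; cases S'; congr

theorem Isomorphic.refl (S : LieTripleSystem F T) : S.Isomorphic S :=
  ⟨LinearEquiv.refl F T, fun _ _ _ => rfl⟩

theorem Isomorphic.symm {S : LieTripleSystem F T} {S' : LieTripleSystem F T'}
    (h : S.Isomorphic S') : S'.Isomorphic S := by
  obtain ⟨φ, hφ⟩ := h
  refine ⟨φ.symm, fun x y z => ?_⟩
  simp [LinearEquiv.symm_apply_eq, hφ]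

theorem Isomorphic.trans {S : LieTripleSystem F T} {S' : LieTripleSystem F T'}
    {S'' : LieTripleSystem F T''} (h : S.Isomorphic S') (h' : S'.Isomorphic S'') :
    S.Isomorphic S'' := by
  obtain ⟨φ, hφ⟩ := h
  obtain ⟨ψ, hψ⟩ := h'
  exact ⟨φ.trans ψ, fun x y z => by simp [hφ, hψ]⟩

theorem bracket_swap (S : LieTripleSystem F T) (x y z : T) :
    S.bracket x y z = -S.bracket y x z :=
  eq_neg_of_add_eq_zero_left (S.skew x y z)

theorem bracket_self (h2 : (2 : F) ≠ 0) (S : LieTripleSystem F T) (x z : T) :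
    S.bracket x x z = 0 := by
  have h := S.skew x x z
  rw [← two_smul F] at h
  exact (smul_eq_zero.mp h).resolve_left h2

theorem bracket_eq_sub (S : LieTripleSystem F T) (x y z : T) :
    S.bracket x y z = S.bracket x z y - S.bracket y z x := by
  have h := S.cyclic x y z
  rw [S.bracket_swap z x y] at h
  rw [← sub_eq_zero, ← h]
  abel

theorem bracket_middle_eq_zero (S : LieTripleSystem F T) {w : T}
    (hw : ∀ x y, S.bracket w x y = 0) (x y : T) : S.bracket x w y = 0 := by
  rw [S.bracket_swap, hw, neg_zero]

theorem bracket_last_eq_zero (S : LieTripleSystem F T) {w : T}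
    (hw : ∀ x y, S.bracket w x y = 0) (x y : T) : S.bracket x y w = 0 := by
  rw [S.bracket_eq_sub, S.bracket_middle_eq_zero hw, S.bracket_middle_eq_zero hw, sub_zero]

theorem map_bracket_of_basis {ι : Type*} (S : LieTripleSystem F T) (S' : LieTripleSystem F T')
    (b : Basis ι F T) (φ : T →ₗ[F] T')
    (h : ∀ i j k, φ (S.bracket (b i) (b j) (b k)) = S'.bracket (φ (b i)) (φ (b j)) (φ (b k)))
    (x y z : T) : φ (S.bracket x y z) = S'.bracket (φ x) (φ y) (φ z) := by
  have hij : ∀ i j z, φ (S.bracket (b i) (b j) z) = S'.bracket (φ (b i)) (φ (b j)) (φ z) :=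
    fun i j z => LinearMap.congr_fun (b.ext fun k => by simpa using h i j k :
      φ ∘ₗ S.bracket (b i) (b j) = S'.bracket (φ (b i)) (φ (b j)) ∘ₗ φ) z
  have hi : ∀ i y z, φ (S.bracket (b i) y z) = S'.bracket (φ (b i)) (φ y) (φ z) :=
    fun i y z => LinearMap.congr_fun (b.ext fun k => by simpa using hij i k z :
      φ ∘ₗ (S.bracket (b i)).flip z = (S'.bracket (φ (b i))).flip (φ z) ∘ₗ φ) y
  exact LinearMap.congr_fun (b.ext fun k => by simpa using hi k y z :
    φ ∘ₗ (S.bracket.flip y).flip z = (S'.bracket.flip (φ y)).flip (φ z) ∘ₗ φ) x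

theorem isomorphic_of_basis (h2 : (2 : F) ≠ 0) {n : ℕ} (S : LieTripleSystem F T)
    (S' : LieTripleSystem F (Fin (n + 1) → F)) (b : Basis (Fin (n + 1)) F T)
    (hc : ∀ x y, S.bracket (b (Fin.last n)) x y = 0)
    (hc' : ∀ x y, S'.bracket (Pi.single (Fin.last n) 1) x y = 0)
    (h : ∀ i j k : Fin n, i < j → b.equivFun (S.bracket (b i.castSucc) (b j.castSucc)
      (b k.castSucc)) = S'.bracket (Pi.single i.castSucc 1) (Pi.single j.castSucc 1)
        (Pi.single k.castSucc 1)) : S.Isomorphic S' := by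
  refine ⟨b.equivFun, map_bracket_of_basis S S' b b.equivFun.toLinearMap fun i j k => ?_⟩
  have hb : ∀ i, b.equivFun (b i) = Pi.single i 1 := fun i => by
    ext t; simp [Pi.single_apply, eq_comm]
  simp only [LinearEquiv.coe_coe, hb]
  induction i using Fin.lastCases with
  | last => rw [hc, hc', map_zero]
  | cast i =>
  induction j using Fin.lastCases with
  | last => rw [S.bracket_middle_eq_zero hc, S'.bracket_middle_eq_zero hc', map_zero]
  | cast j =>
  induction k using Fin.lastCases with
  | last => rw [S.bracket_last_eq_zero hc, S'.bracket_last_eq_zero hc', map_zero]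
  | cast k =>
  rcases lt_trichotomy i j with hij | rfl | hij
  · exact h i j k hij
  · rw [S.bracket_self h2, S'.bracket_self h2, map_zero]
  · rw [S.bracket_swap, S'.bracket_swap, map_neg, h j i k hij]

end Basic

end LieTripleSystem

section Cross

variable {R : Type*} [CommRing R]

theorem cross_mulVec_dotProduct_mulVec (P : Matrix (Fin 3) (Fin 3) R) (x y z : Fin 3 → R) :
    (P *ᵥ x) ⨯₃ (P *ᵥ y) ⬝ᵥ P *ᵥ z = P.det * (x ⨯₃ y ⬝ᵥ z) := by
  simp only [cross_apply, dotProduct, mulVec, Fin.sum_univ_three, det_fin_three, cons_val]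
  ring

theorem cross_dotProduct_mulVec_cyclic (A : Matrix (Fin 3) (Fin 3) R) (x y z : Fin 3 → R) :
    x ⨯₃ y ⬝ᵥ A *ᵥ z + y ⨯₃ z ⬝ᵥ A *ᵥ x + z ⨯₃ x ⬝ᵥ A *ᵥ y = A.trace * (x ⨯₃ y ⬝ᵥ z) := by
  simp only [cross_apply, dotProduct, mulVec, Fin.sum_univ_three, trace_fin_three, cons_val]
  ring

theorem exists_cross_eq_single (i : Fin 3) : ∃ x y : Fin 3 → R, x ⨯₃ y = Pi.single i 1 := by
  refine ⟨Pi.single (i + 1) 1, Pi.single (i + 2) 1, ?_⟩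
  ext j
  fin_cases i <;> fin_cases j <;> simp [cross_apply]

theorem eq_of_cross_dotProduct_mulVec_eq {A B : Matrix (Fin 3) (Fin 3) R}
    (h : ∀ x y z, x ⨯₃ y ⬝ᵥ A *ᵥ z = x ⨯₃ y ⬝ᵥ B *ᵥ z) : A = B := by
  ext i j
  obtain ⟨x, y, hxy⟩ := exists_cross_eq_single (R := R) i
  simpa [hxy] using h x y (Pi.single j 1)

end Cross

section ProjSimilar

variable {n K : Type*} [Fintype n] [DecidableEq n] [Field K] {A B C : Matrix n n K}

/-- Similarity of square matrices up to a nonzero scalar factor, written without inverses. -/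
def ProjSimilar (A B : Matrix n n K) : Prop :=
  ∃ P : Matrix n n K, IsUnit P ∧ ∃ c : K, c ≠ 0 ∧ B * P = c • (P * A)

theorem ProjSimilar.refl (A : Matrix n n K) : ProjSimilar A A :=
  ⟨1, isUnit_one, 1, one_ne_zero, by simp⟩

theorem ProjSimilar.symm (h : ProjSimilar A B) : ProjSimilar B A := by
  obtain ⟨P, hP, c, hc, h⟩ := h
  have hdet := (isUnit_iff_isUnit_det P).mp hP
  refine ⟨P⁻¹, isUnit_nonsing_inv_iff.mpr hP, c⁻¹, inv_ne_zero hc, ?_⟩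
  calc A * P⁻¹ = c⁻¹ • (P⁻¹ * (c • (P * A)) * P⁻¹) := by
        rw [Matrix.mul_smul, nonsing_inv_mul_cancel_left P A hdet, Matrix.smul_mul,
          inv_smul_smul₀ hc]
    _ = c⁻¹ • (P⁻¹ * B) := by
        rw [← h, ← Matrix.mul_assoc, mul_nonsing_inv_cancel_right P _ hdet]

theorem ProjSimilar.trans (hAB : ProjSimilar A B) (hBC : ProjSimilar B C) : ProjSimilar A C := by
  obtain ⟨P, hP, c, hc, hPc⟩ := hAB
  obtain ⟨Q, hQ, d, hd, hQd⟩ := hBC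
  refine ⟨Q * P, hQ.mul hP, d * c, mul_ne_zero hd hc, ?_⟩
  rw [← Matrix.mul_assoc, hQd, Matrix.smul_mul, Matrix.mul_assoc, hPc, Matrix.mul_smul, smul_smul,
    Matrix.mul_assoc]

theorem ProjSimilar.pow {d : ℕ} (h : ProjSimilar A B) (hA : A ^ d = 0) : B ^ d = 0 := by
  obtain ⟨P, hP, c, -, h⟩ := h
  have hpow : ∀ k, B ^ k * P = c ^ k • (P * A ^ k) := fun k => by
    induction k with
    | zero => simp
    | succ k ih =>
      rw [pow_succ, Matrix.mul_assoc, h, Matrix.mul_smul, ← Matrix.mul_assoc, ih, Matrix.smul_mul,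
        smul_smul, Matrix.mul_assoc, ← pow_succ, pow_succ' c]
  exact hP.mul_left_eq_zero.mp (by rw [hpow, hA, Matrix.mul_zero, smul_zero])

theorem projSimilar_diagonal (σ : Equiv.Perm n) {c : K} (hc : c ≠ 0) {d d' : n → K}
    (h : ∀ i, d' (σ i) = c * d i) : ProjSimilar (diagonal d) (diagonal d') := by
  refine ⟨(σ.permMatrix K)ᵀ, ?_, c, hc, ?_⟩
  · rw [isUnit_transpose, isUnit_iff_isUnit_det, det_permutation]
    rcases Int.units_eq_one_or (Equiv.Perm.sign σ) with hσ | hσ <;> simp [hσ]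
  · ext i j
    rcases eq_or_ne i (σ j) with rfl | hij
    · simp [h, PEquiv.toMatrix_apply]
    · simp [PEquiv.toMatrix_apply, Equiv.symm_apply_eq, hij]

end ProjSimilar

section Coordinates

variable (R : Type*) [CommRing R] (n : ℕ)

/-- The projection of `Rⁿ⁺¹` onto its first `n` coordinates. -/
def initₗ : (Fin (n + 1) → R) →ₗ[R] (Fin n → R) :=
  LinearMap.funLeft R R Fin.castSucc

/-- The inclusion of `Rⁿ` into `Rⁿ⁺¹` with last coordinate zero. -/
def snocZeroₗ : (Fin n → R) →ₗ[R] (Fin (n + 1) → R) :=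
  LinearMap.pi (Fin.snoc (α := fun _ => (Fin n → R) →ₗ[R] R) LinearMap.proj 0)

variable {R n}

@[simp]
theorem initₗ_apply (x : Fin (n + 1) → R) (i : Fin n) : initₗ R n x i = x i.castSucc :=
  rfl

@[simp]
theorem initₗ_single_last (r : R) : initₗ R n (Pi.single (Fin.last n) r) = 0 := by
  ext i
  simp

@[simp]
theorem snocZeroₗ_castSucc (v : Fin n → R) (i : Fin n) : snocZeroₗ R n v i.castSucc = v i := by
  simp [snocZeroₗ]

@[simp]
theorem snocZeroₗ_last (v : Fin n → R) : snocZeroₗ R n v (Fin.last n) = 0 := by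
  simp [snocZeroₗ]

@[simp]
theorem initₗ_snocZeroₗ (v : Fin n → R) : initₗ R n (snocZeroₗ R n v) = v := by
  ext i
  simp

theorem snocZeroₗ_initₗ_add (x : Fin (n + 1) → R) :
    snocZeroₗ R n (initₗ R n x) + x (Fin.last n) • Pi.single (Fin.last n) 1 = x := by
  ext i
  induction i using Fin.lastCases <;> simp

end Coordinates

namespace LieTripleSystem

section MatrixSystem

variable {F : Type*} [Field F] {A B : Matrix (Fin 3) (Fin 3) F}

/-- The system `[x, y, z] = det(x, y, A z) e₄` for a traceless matrix `A`, where the determinant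
only sees the first three coordinates. -/
def matSys (A : Matrix (Fin 3) (Fin 3) F) (hA : A.trace = 0) :
    LieTripleSystem F (Fin 4 → F) where
  bracket :=
    LinearMap.mk₂ F
      (fun x y => (dotProductBilin F F (initₗ F 3 x ⨯₃ initₗ F 3 y) ∘ₗ
        A.mulVecLin ∘ₗ initₗ F 3).smulRight (Pi.single (Fin.last 3) 1))
      (by intros; ext; simp [add_smul]) (by intros; ext; simp [mul_smul])
      (by intros; ext; simp [add_smul]) (by intros; ext; simp [mul_smul])
  skew x y z := by
    simp [← add_smul, ← add_dotProduct]
  cyclic x y z := by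
    simp [← add_smul, cross_dotProduct_mulVec_cyclic, hA]
  derivation u v x y z := by
    simp [-Fin.reduceLast]

theorem matSys_bracket (hA : A.trace = 0) (x y z : Fin 4 → F) :
    (matSys A hA).bracket x y z =
      (initₗ F 3 x ⨯₃ initₗ F 3 y ⬝ᵥ A *ᵥ initₗ F 3 z) • Pi.single (Fin.last 3) 1 :=
  rfl

theorem matSys_isomorphic_of_projSimilar (hA : A.trace = 0) (hB : B.trace = 0)
    (h : ProjSimilar A B) : (matSys A hA).Isomorphic (matSys B hB) := by
  obtain ⟨P, hP, c, hc, hPc⟩ := h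
  have hdet : P.det ≠ 0 := ((isUnit_iff_isUnit_det P).mp hP).ne_zero
  let φ : (Fin 4 → F) →ₗ[F] (Fin 4 → F) := snocZeroₗ F 3 ∘ₗ P.mulVecLin ∘ₗ initₗ F 3 +
    ((c * P.det) • LinearMap.proj (Fin.last 3)).smulRight (Pi.single (Fin.last 3) 1)
  have hφi : ∀ x, initₗ F 3 (φ x) = P *ᵥ initₗ F 3 x := fun x => by
    simp [φ, -Fin.reduceLast]
  have hφl : ∀ x, φ x (Fin.last 3) = c * P.det * x (Fin.last 3) := fun x => by
    simp [φ, -Fin.reduceLast]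
  have hφ : Function.Injective φ := by
    refine (injective_iff_map_eq_zero φ).mpr fun x hx => ?_
    have hi : initₗ F 3 x = 0 := mulVec_injective_of_isUnit hP (by simp [← hφi, hx])
    have hl : x (Fin.last 3) = 0 := by simpa [hx, hc, hdet] using hφl x
    rw [← snocZeroₗ_initₗ_add x, hi, hl, map_zero, zero_smul, add_zero]
  refine ⟨LinearEquiv.ofInjectiveEndo φ hφ, fun x y z => ?_⟩
  have hBP : B *ᵥ P *ᵥ initₗ F 3 z = c • P *ᵥ A *ᵥ initₗ F 3 z := by
    rw [mulVec_mulVec, hPc, smul_mulVec, mulVec_mulVec]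
  have hφe : φ (Pi.single (Fin.last 3) 1) = (c * P.det) • Pi.single (Fin.last 3) 1 := by
    simp [φ, -Fin.reduceLast]
  simp only [LinearEquiv.coe_ofInjectiveEndo, matSys_bracket, map_smul, hφe, hφi, hBP,
    dotProduct_smul, cross_mulVec_dotProduct_mulVec, smul_smul, smul_eq_mul]
  congr 1
  ring

theorem exists_map_single_last_eq_smul {hA : A.trace = 0} {hB : B.trace = 0} (hA0 : A ≠ 0)
    (φ : (Fin 4 → F) ≃ₗ[F] (Fin 4 → F))
    (hφ : ∀ x y z, φ ((matSys A hA).bracket x y z) = (matSys B hB).bracket (φ x) (φ y) (φ z)) :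
    ∃ s : F, s ≠ 0 ∧ φ (Pi.single (Fin.last 3) 1) = s • Pi.single (Fin.last 3) 1 := by
  obtain ⟨u, v, w, huvw⟩ : ∃ u v w : Fin 3 → F, u ⨯₃ v ⬝ᵥ A *ᵥ w ≠ 0 := by
    by_contra! h
    exact hA0 (eq_of_cross_dotProduct_mulVec_eq fun u v w => by simp [h u v w])
  have h := hφ (snocZeroₗ F 3 u) (snocZeroₗ F 3 v) (snocZeroₗ F 3 w)
  simp only [matSys_bracket, initₗ_snocZeroₗ, map_smul] at h
  have hs := (inv_smul_eq_iff₀ huvw).mpr h.symm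
  rw [smul_smul] at hs
  refine ⟨_, fun h0 => ?_, hs.symm⟩
  rw [h0, zero_smul, eq_comm, map_eq_zero_iff φ φ.injective, Pi.single_eq_zero_iff] at hs
  exact one_ne_zero hs

theorem projSimilar_of_matSys_isomorphic {hA : A.trace = 0} {hB : B.trace = 0} (hA0 : A ≠ 0)
    (h : (matSys A hA).Isomorphic (matSys B hB)) : ProjSimilar A B := by
  obtain ⟨φ, hφ⟩ := h
  obtain ⟨s, hs0, hs⟩ := exists_map_single_last_eq_smul hA0 φ hφ
  let P := LinearMap.toMatrix' (initₗ F 3 ∘ₗ φ.toLinearMap ∘ₗ snocZeroₗ F 3)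
  have hP : ∀ v, P *ᵥ v = initₗ F 3 (φ (snocZeroₗ F 3 v)) := fun v => by
    simp [P, LinearMap.toMatrix'_mulVec]
  have hPunit : IsUnit P := by
    refine mulVec_injective_iff_isUnit.mp
      ((injective_iff_map_eq_zero P.mulVecLin).mpr fun v hv => ?_)
    have hφv := snocZeroₗ_initₗ_add (φ (snocZeroₗ F 3 v))
    rw [← hP, ← mulVecLin_apply, hv, map_zero, zero_add, ← inv_smul_eq_iff₀ hs0 |>.mpr hs,
      smul_smul, ← map_smul, φ.injective.eq_iff] at hφv
    rw [← initₗ_snocZeroₗ v, ← hφv, map_smul, initₗ_single_last, smul_zero]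
  have hdet : P.det ≠ 0 := ((isUnit_iff_isUnit_det P).mp hPunit).ne_zero
  have hPBP : P * (P⁻¹ * (B * P)) = B * P :=
    mul_nonsing_inv_cancel_left P _ hdet.isUnit
  have hC : P.det • (P⁻¹ * (B * P)) = s • A := eq_of_cross_dotProduct_mulVec_eq fun x y z => by
    have h := congr_fun (hφ (snocZeroₗ F 3 x) (snocZeroₗ F 3 y) (snocZeroₗ F 3 z)) (Fin.last 3)
    simp only [matSys_bracket, ← hP, initₗ_snocZeroₗ, map_smul, hs, mulVec_mulVec _ B P] at h
    rw [← hPBP, ← mulVec_mulVec, cross_mulVec_dotProduct_mulVec] at h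
    simpa [smul_mulVec, mul_comm] using h.symm
  refine ⟨P, hPunit, P.det⁻¹ * s, mul_ne_zero (inv_ne_zero hdet) hs0, ?_⟩
  rw [← hPBP, mul_smul, ← Matrix.mul_smul, ← hC, Matrix.mul_smul, inv_smul_smul₀ hdet]

theorem matSys_isomorphic_iff (hA : A.trace = 0) (hB : B.trace = 0) :
    (matSys A hA).Isomorphic (matSys B hB) ↔ ProjSimilar A B := by
  refine ⟨fun h => ?_, matSys_isomorphic_of_projSimilar hA hB⟩
  rcases eq_or_ne A 0 with rfl | hA0
  · rcases eq_or_ne B 0 with rfl | hB0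
    · exact .refl 0
    · exact (projSimilar_of_matSys_isomorphic hB0 h.symm).symm
  · exact projSimilar_of_matSys_isomorphic hA0 h

end MatrixSystem

end LieTripleSystem

namespace LieTripleSystem

section MatrixModels

variable {F : Type*} [Field F]

theorem matSys_bracket_eq_smul {A : Matrix (Fin 3) (Fin 3) F} (hA : A.trace = 0)
    (x y z : Fin 4 → F) : (matSys A hA).bracket x y z =
      ((x 1 * y 2 - x 2 * y 1) * (A 0 0 * z 0 + A 0 1 * z 1 + A 0 2 * z 2) +
       (x 2 * y 0 - x 0 * y 2) * (A 1 0 * z 0 + A 1 1 * z 1 + A 1 2 * z 2) +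
       (x 0 * y 1 - x 1 * y 0) * (A 2 0 * z 0 + A 2 1 * z 1 + A 2 2 * z 2)) • Pi.single 3 1 := by
  simp only [matSys_bracket, cross_apply, dotProduct, mulVec, Fin.sum_univ_three, cons_val,
    initₗ_apply]
  rfl

theorem T41_eq_matSys : T41 F = matSys 0 (trace_zero _ _) := by
  ext x y z t
  simp [T41, matSys_bracket_eq_smul]

theorem T42_isomorphic_matSys :
    (T42 F).Isomorphic (matSys !![0, 1, 0; 0, 0, 0; 0, 0, 0] (by simp [trace_fin_three])) := by
  refine ⟨LinearEquiv.funCongrLeft F F (Equiv.subRight 1), fun x y z => ?_⟩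
  ext t
  fin_cases t <;> simp [T42, elem_apply, matSys_bracket_eq_smul, show (-1 : Fin 4) = 3 from rfl]

theorem T44_eq_matSys :
    T44 F = matSys !![0, 1, 0; 0, 0, 1; 0, 0, 0] (by simp [trace_fin_three]) := by
  ext x y z t
  simp [T44, elem_apply, matSys_bracket_eq_smul]
  ring

theorem T45_eq_matSys :
    T45 F = matSys !![1, 1, 0; 0, 1, 0; 0, 0, -2] (by simp [trace_fin_three]; norm_num) := by
  ext x y z t
  simp [T45, elem_apply, matSys_bracket_eq_smul]
  ring

theorem T46_eq_matSys (a : F) :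
    T46 F a = matSys (diagonal ![a, 1, -(a + 1)]) (by simp [Fin.sum_univ_three]) := by
  ext x y z t
  simp [T46, elem_apply, matSys_bracket_eq_smul]
  ring

end MatrixModels

end LieTripleSystem

section Jordan

variable {K V : Type*} [Field K] [AddCommGroup V] [Module K V] {f : End K V}

theorem toMatrix_eq_of_apply_eq_sum {n : Type*} [Fintype n] [DecidableEq n] {b : Basis n K V}
    {M : Matrix n n K} (h : ∀ j, f (b j) = ∑ i, M i j • b i) : LinearMap.toMatrix b b f = M := by
  rw [← LinearMap.toMatrix_toLin b b M]
  congr 1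
  exact b.ext fun j => by rw [h, toLin_self]

theorem exists_basis_toMatrix_eq_diagonal [FiniteDimensional K V] {n : ℕ} (hn : finrank K V = n)
    (hf : ⨆ μ, f.eigenspace μ = ⊤) :
    ∃ (b : Basis (Fin n) K V) (d : Fin n → K), LinearMap.toMatrix b b f = diagonal d := by
  have hspan : ⊤ ≤ Submodule.span K {v | ∃ μ : K, f v = μ • v} := by
    rw [← hf, iSup_le_iff]
    exact fun μ v hv => Submodule.subset_span ⟨μ, End.mem_eigenspace_iff.mp hv⟩
  let b₀ := Basis.ofSpan hspan
  let b := b₀.reindex (Fintype.equivFinOfCardEq ((finrank_eq_card_basis b₀).symm.trans hn))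
  have hb : ∀ i, ∃ μ : K, f (b i) = μ • b i := fun i => by
    rw [Basis.reindex_apply]
    exact Basis.ofSpan_subset hspan ⟨_, rfl⟩
  choose d hd using hb
  refine ⟨b, d, ?_⟩
  ext i j
  rcases eq_or_ne i j with rfl | hij
  · simp [LinearMap.toMatrix_apply, hd]
  · simp [LinearMap.toMatrix_apply, hd, hij]

theorem iSup_eigenspace_eq_top_or_exists (hf : ⨆ μ, f.maxGenEigenspace μ = ⊤) :
    ⨆ μ, f.eigenspace μ = ⊤ ∨ ∃ (μ : K) (u v : V), u ≠ 0 ∧ f u = μ • u ∧ f v = u + μ • v := by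
  by_contra! h
  obtain ⟨hne, h⟩ := h
  refine hne (top_le_iff.mp (hf.ge.trans (iSup_mono fun μ v hv => ?_)))
  obtain ⟨k, hk⟩ := (End.mem_maxGenEigenspace f μ v).mp hv
  clear hv
  induction k generalizing v with
  | zero => simp_all
  | succ k ih =>
    have hfv : f (f v - μ • v) = μ • (f v - μ • v) :=
      End.mem_eigenspace_iff.mp (ih (f v - μ • v) (by simpa [pow_succ] using hk))
    rw [End.mem_eigenspace_iff]
    by_contra hv
    exact h μ (f v - μ • v) v (sub_ne_zero.mpr hv) hfv (sub_add_cancel _ _).symm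

theorem exists_basis_of_linearIndependent_pair (hV : finrank K V = 3) {u v : V}
    (huv : LinearIndependent K ![u, v]) : ∃ b : Basis (Fin 3) K V, b 0 = u ∧ b 1 = v := by
  obtain ⟨z, hz⟩ := exists_linearIndependent_snoc_of_lt_finrank huv (by omega)
  have : FiniteDimensional K V := .of_finrank_pos (by simp [hV])
  refine ⟨basisOfLinearIndependentOfCardEqFinrank hz (by simp [hV]), ?_, ?_⟩ <;>
    rw [coe_basisOfLinearIndependentOfCardEqFinrank] <;> rfl

theorem linearIndependent_add_smul_add_smul (b : Basis (Fin 3) K V) (p q : K) :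
    LinearIndependent K ![b 0, b 1, b 2 + p • b 1 + q • b 0] := by
  refine (b.is_basis_iff_det.mpr ?_).1
  simp [Basis.det_apply, det_fin_three, Basis.toMatrix_apply]

theorem exists_apply_eq_smul_or_exists (hV : finrank K V = 3) {μ : K} {u v : V} (hu0 : u ≠ 0)
    (hu : f u = μ • u) (hv : f v = u + μ • v) :
    ∃ w, LinearIndependent K ![u, v, w] ∧
      ((∃ ν : K, f w = ν • w) ∨ ∃ α : K, α ≠ 0 ∧ f w = α • v + μ • w) := by
  have huv : LinearIndependent K ![u, v] := by
    refine (LinearIndependent.pair_iff' hu0).mpr fun a hav => hu0 ?_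
    rw [← hav, map_smul, hu, smul_comm a] at hv
    exact right_eq_add.mp hv
  obtain ⟨b, rfl, rfl⟩ := exists_basis_of_linearIndependent_pair hV huv
  have hb := linearIndependent_add_smul_add_smul b
  obtain ⟨α, β, ν, hfz⟩ : ∃ α β ν : K, f (b 2) = α • b 1 + β • b 0 + ν • b 2 :=
    ⟨_, _, _, by rw [← b.sum_repr (f (b 2)), Fin.sum_univ_three, add_comm (_ • b 0)]⟩
  rcases ne_or_eq ν μ with hνμ | rfl
  · have hd := sub_ne_zero.mpr hνμ
    refine ⟨_, hb (α / (ν - μ)) ((β + α / (ν - μ)) / (ν - μ)), .inl ⟨ν, ?_⟩⟩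
    simp only [map_add, map_smul, hfz, hu, hv]
    match_scalars <;> field_simp <;> ring
  · rcases eq_or_ne α 0 with rfl | hα
    · refine ⟨_, hb (-β) 0, .inl ⟨ν, ?_⟩⟩
      simp only [map_add, map_smul, hfz, hu, hv]
      module
    · refine ⟨_, hb (-β) 0, .inr ⟨α, hα, ?_⟩⟩
      simp only [map_add, map_smul, hfz, hu, hv]
      module

theorem exists_basis_toMatrix_fin_three (hV : finrank K V = 3)
    (hf : ⨆ μ, f.maxGenEigenspace μ = ⊤) :
    ∃ b : Basis (Fin 3) K V,
      (∃ d, LinearMap.toMatrix b b f = diagonal d) ∨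
      (∃ a c, LinearMap.toMatrix b b f = !![a, 1, 0; 0, a, 0; 0, 0, c]) ∨
      ∃ a, LinearMap.toMatrix b b f = !![a, 1, 0; 0, a, 1; 0, 0, a] := by
  have : FiniteDimensional K V := .of_finrank_pos (by simp [hV])
  obtain hdiag | ⟨μ, u, v, hu0, hu, hv⟩ := iSup_eigenspace_eq_top_or_exists hf
  · obtain ⟨b, d, hb⟩ := exists_basis_toMatrix_eq_diagonal hV hdiag
    exact ⟨b, .inl ⟨d, hb⟩⟩
  obtain ⟨w, huvw, ⟨ν, hw⟩ | ⟨α, hα, hw⟩⟩ := exists_apply_eq_smul_or_exists hV hu0 hu hv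
  · refine ⟨basisOfLinearIndependentOfCardEqFinrank huvw (by simp [hV]), .inr (.inl ⟨μ, ν, ?_⟩)⟩
    refine toMatrix_eq_of_apply_eq_sum fun j => ?_
    fin_cases j <;> simp [Fin.sum_univ_three, hu, hv, hw]
  · have huvw' : LinearIndependent K ![α • u, α • v, w] := by
      convert huvw.units_smul ![.mk0 α hα, .mk0 α hα, 1] using 1
      ext i
      fin_cases i <;> simp [Units.smul_def]
    refine ⟨basisOfLinearIndependentOfCardEqFinrank huvw' (by simp [hV]), .inr (.inr ⟨μ, ?_⟩)⟩
    refine toMatrix_eq_of_apply_eq_sum fun j => ?_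
    fin_cases j <;> simp [Fin.sum_univ_three, hu, hv, hw, smul_comm α μ]

end Jordan

section Splitting

open Polynomial

variable {K V : Type*} [Field K] [AddCommGroup V] [Module K V] {f : End K V}

theorem ker_aeval_X_sub_C_pow_le (μ : K) (k : ℕ) :
    LinearMap.ker (aeval f ((X - C μ) ^ k)) ≤ f.maxGenEigenspace μ := fun v hv => by
  refine (End.mem_maxGenEigenspace f μ v).mpr ⟨k, ?_⟩
  simpa [Algebra.algebraMap_eq_smul_one] using hv

theorem ker_aeval_le_iSup_maxGenEigenspace {p : K[X]} (hp0 : p ≠ 0) (hp : p.Splits) :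
    LinearMap.ker (aeval f p) ≤ ⨆ μ, f.maxGenEigenspace μ := by
  induction p using UniqueFactorizationMonoid.induction_on_coprime with
  | h0 => exact absurd rfl hp0
  | h1 hu =>
    obtain ⟨r, hr, rfl⟩ := isUnit_iff.mp hu
    intro v hv
    simp_all
  | @hpr q i hq =>
    rcases eq_or_ne i 0 with rfl | hi
    · rw [pow_zero, map_one, End.one_eq_id, LinearMap.ker_id]
      exact bot_le
    have hqs : q.Splits := hp.of_dvd hp0 (dvd_pow_self q hi)
    obtain ⟨μ, hμ⟩ := hqs.exists_eval_eq_zero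
      (by rw [hqs.degree_eq_one_of_irreducible hq.irreducible]; exact one_ne_zero)
    have hdvd : q ∣ X - C μ :=
      (irreducible_X_sub_C μ).dvd_symm hq.irreducible (dvd_iff_isRoot.mpr hμ)
    obtain ⟨r, hr⟩ := pow_dvd_pow_of_dvd hdvd i
    refine le_trans (fun v hv => ?_) ((ker_aeval_X_sub_C_pow_le μ i).trans (le_iSup _ μ))
    rw [hr, mul_comm, LinearMap.mem_ker, map_mul, End.mul_apply, LinearMap.mem_ker.mp hv, map_zero]
  | hcp hcop ihx ihy =>
    obtain ⟨hx0, hy0⟩ := mul_ne_zero_iff.mp hp0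
    obtain ⟨hx, hy⟩ := (splits_mul hx0 hy0).mp hp
    rw [← sup_ker_aeval_eq_ker_aeval_mul_of_coprime f hcop.isCoprime]
    exact sup_le (ihx hx0 hx) (ihy hy0 hy)

theorem iSup_maxGenEigenspace_eq_top_of_splits_charpoly [FiniteDimensional K V]
    (hf : f.charpoly.Splits) : ⨆ μ, f.maxGenEigenspace μ = ⊤ := by
  have h := ker_aeval_le_iSup_maxGenEigenspace (f := f) f.charpoly_monic.ne_zero hf
  rwa [LinearMap.aeval_self_charpoly, LinearMap.ker_zero, top_le_iff] at h

end Splitting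

section ProjSimilar

variable {K n : Type*} [Field K] [Fintype n] [DecidableEq n] {A B : Matrix n n K}

theorem projSimilar_toMatrix {V : Type*} [AddCommGroup V] [Module K V] (f : End K V)
    (b b' : Basis n K V) :
    ProjSimilar (LinearMap.toMatrix b b f) (LinearMap.toMatrix b' b' f) := by
  refine ⟨b'.toMatrix b, ?_, 1, one_ne_zero, ?_⟩
  · have := b'.invertibleToMatrix b
    exact isUnit_of_invertible _
  · rw [one_smul, linearMap_toMatrix_mul_basis_toMatrix, basis_toMatrix_mul_linearMap_toMatrix]

theorem ProjSimilar.exists_det_smul_one_sub (h : ProjSimilar A B) :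
    ∃ c : K, c ≠ 0 ∧ ∀ x, ((c * x) • 1 - B).det = c ^ Fintype.card n * (x • 1 - A).det := by
  obtain ⟨P, hP, c, hc, h⟩ := h
  have hdet : IsUnit P.det := (isUnit_iff_isUnit_det P).mp hP
  refine ⟨c, hc, fun x => hdet.mul_right_cancel ?_⟩
  have hmul : ((c * x) • 1 - B) * P = c • (P * (x • 1 - A)) := by
    rw [Matrix.sub_mul, h, Matrix.mul_sub, smul_sub, Matrix.mul_smul, Matrix.smul_mul,
      Matrix.one_mul, Matrix.mul_one, smul_smul]
  rw [← det_mul, hmul, det_smul, det_mul]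
  ring

theorem ProjSimilar.exists_mulVec_eq_smul {d : n → K} (h : ProjSimilar (diagonal d) A) (i : n) :
    ∃ (v : n → K) (μ : K), A *ᵥ v = μ • v ∧ v i ≠ 0 := by
  obtain ⟨P, hP, c, -, h⟩ := h
  by_contra! hv
  refine ((isUnit_iff_isUnit_det P).mp hP).ne_zero (det_eq_zero_of_row_eq_zero i fun j => ?_)
  refine hv (P.col j) (c * d j) (funext fun k => ?_)
  have := congr_fun₂ h k j
  rw [mul_apply, Matrix.smul_apply, mul_diagonal] at this
  simpa [mulVec, dotProduct, mul_comm, mul_left_comm] using this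

theorem ProjSimilar.trace_eq_zero (h : ProjSimilar A B) (hA : A.trace = 0) : B.trace = 0 := by
  obtain ⟨P, hP, c, -, h⟩ := h
  have hdet := (isUnit_iff_isUnit_det P).mp hP
  rw [← mul_nonsing_inv_cancel_right P B hdet, h, Matrix.smul_mul, trace_smul, trace_mul_cycle,
    nonsing_inv_mul P hdet, Matrix.one_mul, hA, smul_zero]

theorem exists_projSimilar_fin_three {A : Matrix (Fin 3) (Fin 3) K} (hA : A.charpoly.Splits) :
    (∃ d, ProjSimilar A (diagonal d)) ∨
      (∃ a c, ProjSimilar A !![a, 1, 0; 0, a, 0; 0, 0, c]) ∨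
      ∃ a, ProjSimilar A !![a, 1, 0; 0, a, 1; 0, 0, a] := by
  obtain ⟨b, hb⟩ := exists_basis_toMatrix_fin_three (f := Matrix.toLin' A) (by simp)
    (iSup_maxGenEigenspace_eq_top_of_splits_charpoly (by rwa [charpoly_toLin']))
  have hAb := projSimilar_toMatrix (Matrix.toLin' A) (Pi.basisFun K (Fin 3)) b
  rw [LinearMap.toMatrix_eq_toMatrix', LinearMap.toMatrix'_toLin'] at hAb
  refine hb.imp ?_ (.imp ?_ ?_)
  · rintro ⟨d, hd⟩
    exact ⟨d, hd ▸ hAb⟩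
  · rintro ⟨a, c, hac⟩
    exact ⟨a, c, hac ▸ hAb⟩
  · rintro ⟨a, ha⟩
    exact ⟨a, ha ▸ hAb⟩

theorem projSimilar_diagonal_of_ne_zero {d : Fin 3 → K} {i : Fin 3} (hi : d i ≠ 0)
    (hd : ∑ j, d j = 0) : ∃ α, ProjSimilar (diagonal d) (diagonal ![α, 1, -(α + 1)]) := by
  let σ := Equiv.swap i 1
  have hσ : ∑ j, d (σ j) = 0 := (Equiv.sum_comp σ d).trans hd
  rw [Fin.sum_univ_three] at hσ
  have hσ1 : d (σ 1) = d i := by simp [σ]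
  refine ⟨(d i)⁻¹ * d (σ 0), projSimilar_diagonal σ.symm (inv_ne_zero hi) fun k => ?_⟩
  obtain ⟨j, rfl⟩ := σ.surjective k
  rw [σ.symm_apply_apply]
  fin_cases j
  · rfl
  · simp [hσ1, hi]
  · have : d (σ 2) = -(d (σ 0) + d (σ 1)) := by linear_combination hσ
    simp [this, hσ1]
    field_simp

theorem projSimilar_jordan_of_ne_zero {a c : K} (ha : a ≠ 0) (hac : a + a + c = 0) :
    ProjSimilar !![a, 1, 0; 0, a, 0; 0, 0, c] !![1, 1, 0; 0, 1, 0; 0, 0, -2] := by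
  have hc : c = -2 * a := by linear_combination hac
  refine ⟨diagonal ![a, 1, 1], ?_, a⁻¹, inv_ne_zero ha, ?_⟩
  · simp [isUnit_iff_isUnit_det, Fin.prod_univ_three, ha]
  · ext i j
    fin_cases i <;> fin_cases j <;> simp [mul_apply, Fin.sum_univ_three, ha, hc]
    field_simp

end ProjSimilar

namespace LieTripleSystem

section MatrixClassification

variable {F : Type*} [Field F] {A : Matrix (Fin 3) (Fin 3) F}

theorem exists_label_matSys (h3 : (3 : F) ≠ 0) (hA : A.trace = 0) (hsplit : A.charpoly.Splits) :
    ∃ l : Label F, (matSys A hA).Isomorphic l.system := by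
  obtain ⟨d, hd⟩ | ⟨a, c, hac⟩ | ⟨a, ha⟩ := exists_projSimilar_fin_three hsplit
  · have htr := hd.trace_eq_zero hA
    rw [trace_diagonal] at htr
    by_cases hd0 : ∃ i, d i ≠ 0
    · obtain ⟨i, hi⟩ := hd0
      obtain ⟨α, hα⟩ := projSimilar_diagonal_of_ne_zero hi htr
      refine ⟨.t6 α, ?_⟩
      rw [Label.system, T46_eq_matSys, matSys_isomorphic_iff]
      exact hd.trans hα
    · push Not at hd0
      obtain rfl : d = 0 := funext hd0
      refine ⟨.t1, ?_⟩
      rw [Label.system, T41_eq_matSys, matSys_isomorphic_iff]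
      simpa using hd
  · have htr : a + a + c = 0 := by simpa [trace_fin_three] using hac.trace_eq_zero hA
    rcases eq_or_ne a 0 with rfl | ha
    · obtain rfl : c = 0 := by simpa using htr
      exact ⟨.t2, .trans ((matSys_isomorphic_iff _ _).mpr hac) T42_isomorphic_matSys.symm⟩
    · refine ⟨.t5, ?_⟩
      rw [Label.system, T45_eq_matSys, matSys_isomorphic_iff]
      exact hac.trans (projSimilar_jordan_of_ne_zero ha htr)
  · have htr : a + a + a = 0 := by simpa [trace_fin_three] using ha.trace_eq_zero hA
    obtain rfl : a = 0 :=
      (mul_eq_zero.mp (by linear_combination htr : (3 : F) * a = 0)).resolve_left h3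
    refine ⟨.t4, ?_⟩
    rw [Label.system, T44_eq_matSys, matSys_isomorphic_iff]
    exact ha

end MatrixClassification

end LieTripleSystem

namespace LieTripleSystem

section Family

variable {F : Type*} [Field F] {α β : F}

theorem T46_isomorphic_of_perm (σ : Equiv.Perm (Fin 3)) {c : F} (hc : c ≠ 0)
    (h : ∀ i, ![β, 1, -(β + 1)] (σ i) = c * ![α, 1, -(α + 1)] i) :
    (T46 F α).Isomorphic (T46 F β) := by
  rw [T46_eq_matSys, T46_eq_matSys, matSys_isomorphic_iff]
  exact projSimilar_diagonal σ hc h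

theorem T46_isomorphic_of_add_add_one_eq_zero (h : α + β + 1 = 0) :
    (T46 F α).Isomorphic (T46 F β) := by
  obtain rfl : β = -(α + 1) := by linear_combination h
  refine T46_isomorphic_of_perm (Equiv.swap 0 2) one_ne_zero fun i => ?_
  fin_cases i <;> simp [Equiv.swap_apply_def]

theorem xi_eq_div_sq (γ : F) : xi γ = (γ ^ 2 + γ + 1) ^ 3 / (γ ^ 2 + γ) ^ 2 := by
  rw [xi]
  congr 1
  ring

theorem xi_eq_xi_factor (hα : α ^ 2 + α ≠ 0) (hβ : β ^ 2 + β ≠ 0) (h : xi α = xi β) :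
    (α - β) * (α + β + 1) * (α * β - 1) * (α * β + α + 1) * (α * β + β + 1) *
      (α + β + α * β) = 0 := by
  rw [xi_eq_div_sq, xi_eq_div_sq, div_eq_div_iff (pow_ne_zero 2 hα) (pow_ne_zero 2 hβ)] at h
  linear_combination h

theorem T46_isomorphic_of_xi_eq (hα : α ^ 2 + α ≠ 0) (hβ : β ^ 2 + β ≠ 0) (h : xi α = xi β) :
    (T46 F α).Isomorphic (T46 F β) := by
  have hf := xi_eq_xi_factor hα hβ h
  have hβ' : β * (β + 1) ≠ 0 := by rwa [mul_add_one, ← sq]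
  have hβ0 : β ≠ 0 := left_ne_zero_of_mul hβ'
  have hβ1 : -(β + 1) ≠ 0 := neg_ne_zero.mpr (right_ne_zero_of_mul hβ')
  simp only [mul_eq_zero] at hf
  obtain ((((hf | hf) | hf) | hf) | hf) | hf := hf
  · exact sub_eq_zero.mp hf ▸ .refl _
  · exact T46_isomorphic_of_add_add_one_eq_zero hf
  · refine T46_isomorphic_of_perm (Equiv.swap 0 1) hβ0 fun i => ?_
    fin_cases i <;> simp [Equiv.swap_apply_def] <;> grind
  · refine T46_isomorphic_of_perm (finRotate 3) hβ1 fun i => ?_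
    fin_cases i <;> simp <;> grind
  · refine T46_isomorphic_of_perm (finRotate 3).symm hβ0 fun i => ?_
    fin_cases i <;> simp <;> grind
  · refine T46_isomorphic_of_perm (Equiv.swap 1 2) hβ1 fun i => ?_
    fin_cases i <;> simp [Equiv.swap_apply_def] <;> grind

theorem exists_scaling_of_T46_isomorphic (h : (T46 F α).Isomorphic (T46 F β)) :
    ∃ c : F, c ≠ 0 ∧ β ^ 2 + β = c ^ 3 * (α ^ 2 + α) ∧
      β ^ 2 + β + 1 = c ^ 2 * (α ^ 2 + α + 1) := by
  rw [T46_eq_matSys, T46_eq_matSys, matSys_isomorphic_iff] at h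
  obtain ⟨c, hc, hdet⟩ := h.exists_det_smul_one_sub
  have hdet' : ∀ x : F, (c * x - β) * (c * x - 1) * (c * x + β + 1) =
      c ^ 3 * ((x - α) * (x - 1) * (x + α + 1)) := fun x => by
    have hx := hdet x
    simp only [smul_one_eq_diagonal, diagonal_sub, det_diagonal, Fin.prod_univ_three, cons_val,
      Fintype.card_fin] at hx
    linear_combination hx
  have h0 := hdet' 0
  refine ⟨c, hc, by linear_combination h0, mul_left_cancel₀ hc ?_⟩
  linear_combination h0 - hdet' 1

theorem T46_isomorphic_cases (h : (T46 F α).Isomorphic (T46 F β)) :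
    α = β ∨ (α = 0 ∧ β = -1) ∨ (α = -1 ∧ β = 0) ∨
      (α ^ 2 + α ≠ 0 ∧ β ^ 2 + β ≠ 0 ∧ xi α = xi β) := by
  obtain ⟨c, hc, h3, h2⟩ := exists_scaling_of_T46_isomorphic h
  have hroot : ∀ γ : F, γ ^ 2 + γ = 0 → γ = 0 ∨ γ = -1 := fun γ hγ => by
    rw [sq, ← mul_add_one] at hγ
    exact (mul_eq_zero.mp hγ).imp_right eq_neg_of_add_eq_zero_left
  by_cases hα : α ^ 2 + α = 0
  · have hβ : β ^ 2 + β = 0 := by rw [h3, hα, mul_zero]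
    rcases hroot α hα with rfl | rfl <;> rcases hroot β hβ with rfl | rfl <;> simp
  · have hβ : β ^ 2 + β ≠ 0 := h3 ▸ mul_ne_zero (pow_ne_zero 3 hc) hα
    refine .inr (.inr (.inr ⟨hα, hβ, ?_⟩))
    rw [xi_eq_div_sq, xi_eq_div_sq, div_eq_div_iff (pow_ne_zero 2 hα) (pow_ne_zero 2 hβ), h2, h3]
    ring

theorem not_isomorphic_T46_T45 (α : F) : ¬ (T46 F α).Isomorphic (T45 F) := by
  rw [T46_eq_matSys, T45_eq_matSys, matSys_isomorphic_iff]
  intro h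
  obtain ⟨v, μ, hv, hv1⟩ := h.exists_mulVec_eq_smul 1
  have h1 : v 1 = μ * v 1 := by
    simpa [mulVec, dotProduct, Fin.sum_univ_three] using congr_fun hv 1
  obtain rfl : 1 = μ := mul_right_cancel₀ hv1 (by rwa [one_mul])
  have h0 : v 0 + v 1 = v 0 := by
    simpa [mulVec, dotProduct, Fin.sum_univ_three] using congr_fun hv 0
  exact hv1 (add_eq_left.mp h0)

end Family

end LieTripleSystem

namespace LieTripleSystem

section Flag

variable {F T : Type*} [Field F] [AddCommGroup T] [Module F T] {S : LieTripleSystem F T}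

theorem bracket_mem_series_succ {n : ℕ} {x : T} (hx : x ∈ S.series ⊤ n) (y z : T) :
    S.bracket x y z ∈ S.series ⊤ (n + 1) :=
  Submodule.mem_sup_left (Submodule.subset_span ⟨x, hx, y, trivial, z, trivial, rfl⟩)

theorem IsNilpotent.exists_bracket_mem (hS : S.IsNilpotent) {W : Submodule F T} (hW : W ≠ ⊤) :
    ∃ z ∉ W, ∀ x y, S.bracket z x y ∈ W := by
  classical
  have hex : ∃ n, S.series ⊤ n ≤ W := hS.imp fun m hm => hm.trans_le bot_le
  obtain ⟨k, hk⟩ : ∃ k, Nat.find hex = k + 1 :=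
    Nat.exists_eq_succ_of_ne_zero fun h0 => hW (top_le_iff.mp ((Nat.find_eq_zero hex).mp h0))
  obtain ⟨z, hz, hzW⟩ := SetLike.not_le_iff_exists.mp (Nat.find_min hex (m := k) (by omega))
  exact ⟨z, hzW, fun x y => hk ▸ Nat.find_spec hex <| bracket_mem_series_succ hz x y⟩

theorem IsNilpotent.exists_linearIndependent_flag (hS : S.IsNilpotent) {n : ℕ}
    (hn : n ≤ finrank F T) : ∃ v : Fin n → T, LinearIndependent F v ∧
      ∀ i x y, S.bracket (v i) x y ∈ Submodule.span F (v '' Set.Ioi i) := by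
  induction n with
  | zero => exact ⟨0, linearIndependent_empty_type, fun i => i.elim0⟩
  | succ n ih =>
    obtain ⟨v, hv, hflag⟩ := ih (n.le_succ.trans hn)
    have hspan : Submodule.span F (Set.range v) ≠ ⊤ := fun htop => by
      have hfin := finrank_range_le_card (R := F) v
      rw [Set.finrank, htop, finrank_top, Fintype.card_fin] at hfin
      omega
    obtain ⟨z, hz, hzflag⟩ := hS.exists_bracket_mem hspan
    refine ⟨Fin.cons z v, linearIndependent_finCons.mpr ⟨hv, hz⟩, Fin.cases ?_ fun i => ?_⟩
    · have hIoi : Set.Ioi (0 : Fin (n + 1)) = Set.range Fin.succ := by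
        ext i; simp [Fin.pos_iff_ne_zero]
      simpa [hIoi, -Fin.range_succ, ← Set.range_comp, Function.comp_def] using hzflag
    · simpa [← Fin.image_succ_Ioi, Set.image_image] using hflag i

theorem IsNilpotent.exists_flag_basis [FiniteDimensional F T] (hS : S.IsNilpotent) {n : ℕ}
    (hn : finrank F T = n) : ∃ b : Basis (Fin n) F T,
      ∀ i x y, S.bracket (b i) x y ∈ Submodule.span F (b '' Set.Ioi i) := by
  obtain ⟨v, hv, hflag⟩ := hS.exists_linearIndependent_flag hn.ge
  have hspan := hv.span_eq_top_of_card_eq_finrank' (by simp [hn])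
  exact ⟨Basis.mk hv hspan.ge, by simpa using hflag⟩

end Flag

section RankOne

variable {F T : Type*} [Field F] [AddCommGroup T] [Module F T]

theorem exists_isomorphic_matSys (h2 : (2 : F) ≠ 0) (S : LieTripleSystem F T)
    (b : Basis (Fin 4) F T) (hc : ∀ x y, S.bracket (b 3) x y = 0)
    (h : ∀ i j k : Fin 3, i < j → S.bracket (b i.castSucc) (b j.castSucc) (b k.castSucc) ∈
      Submodule.span F {b 3}) :
    ∃ (A : Matrix (Fin 3) (Fin 3) F) (hA : A.trace = 0), S.Isomorphic (matSys A hA) := by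
  simp only [Submodule.mem_span_singleton] at h
  choose p hp using fun k => h 0 1 k (by decide)
  choose q hq using fun k => h 0 2 k (by decide)
  choose r hr using fun k => h 1 2 k (by decide)
  have htrace : (of ![r, -q, p]).trace = 0 := by
    have hcyc := S.cyclic (b 0) (b 1) (b 2)
    rw [S.bracket_swap (b 2) (b 0), ← show _ = S.bracket (b 0) (b 1) (b 2) from hp 2,
      ← show _ = S.bracket (b 1) (b 2) (b 0) from hr 0,
      ← show _ = S.bracket (b 0) (b 2) (b 1) from hq 1, ← neg_smul, ← add_smul, ← add_smul] at hcyc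
    have hsum := (smul_eq_zero.mp hcyc).resolve_right (b.ne_zero 3)
    simp only [trace_fin_three, of_apply, cons_val, Pi.neg_apply]
    linear_combination hsum
  refine ⟨_, htrace, isomorphic_of_basis h2 S _ b hc (fun x y => ?_) fun i j k hij => ?_⟩
  · simp [matSys_bracket_eq_smul]
  · have hb : b.equivFun (b 3) = Pi.single 3 1 := by
      ext t; simp [Pi.single_apply, eq_comm]
    rw [matSys_bracket_eq_smul]
    obtain ⟨rfl, rfl⟩ | ⟨rfl, rfl⟩ | ⟨rfl, rfl⟩ :
        i = 0 ∧ j = 1 ∨ i = 0 ∧ j = 2 ∨ i = 1 ∧ j = 2 := by omega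
    · rw [← hp, map_smul, hb]
      fin_cases k <;> simp
    · rw [← hq, map_smul, hb]
      fin_cases k <;> simp
    · rw [← hr, map_smul, hb]
      fin_cases k <;> simp

end RankOne

end LieTripleSystem

namespace LieTripleSystem

section Filiform

variable {F T : Type*} [Field F] [AddCommGroup T] [Module F T]

/-- The system `[e₁, e₂, e₁] = e₃`, `[e₁, e₂, e₂] = a e₄`, `[e₁, e₂, e₃] = [e₁, e₃, e₂] = b e₄`,
`[e₁, e₃, e₁] = c e₄` on `F⁴`, the common shape of `T42`, `T43`, `T47`, `T48` and `T49`. -/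
def filiform (a b c : F) : LieTripleSystem F (Fin 4 → F) where
  bracket := elem F 0 1 0 2 + a • elem F 0 1 1 3 + b • (elem F 0 1 2 3 + elem F 0 2 1 3) +
    c • elem F 0 2 0 3
  skew x y z := by ext t; fin_cases t <;> simp [elem_apply] <;> ring
  cyclic x y z := by ext t; fin_cases t <;> simp [elem_apply] <;> ring
  derivation u v x y z := by ext t; fin_cases t <;> simp [elem_apply]; ring

theorem filiform_bracket (a b c : F) (x y z : Fin 4 → F) :
    (filiform a b c).bracket x y z = ![0, 0, (x 0 * y 1 - x 1 * y 0) * z 0,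
      (x 0 * y 1 - x 1 * y 0) * (a * z 1 + b * z 2) +
        (x 0 * y 2 - x 2 * y 0) * (b * z 1 + c * z 0)] := by
  ext t
  fin_cases t <;> simp [filiform, elem_apply]
  ring

theorem T42_eq_filiform : T42 F = filiform 0 0 0 := by
  ext : 1
  simp [T42, filiform]

theorem T43_eq_filiform : T43 F = filiform 1 0 0 := by
  ext : 1
  simp [T43, filiform]

theorem T47_eq_filiform : T47 F = filiform 0 1 0 := by
  ext : 1
  simp [T47, filiform, add_assoc]

theorem T48_eq_filiform : T48 F = filiform 1 0 1 := by
  ext : 1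
  simp [T48, filiform]
  abel

theorem T49_eq_filiform : T49 F = filiform 0 0 1 := by
  ext : 1
  simp [T49, filiform]

-- The new basis is `e₁ + s e₂`, `t e₂ + u e₃`, `t e₃ + (ats + bus + cu) e₄`, `w e₄`.
theorem filiform_isomorphic_filiform {a b c a' b' c' t w : F} (s u : F) (ht : t ≠ 0) (hw : w ≠ 0)
    (ha : a' * w = t * (a * t + 2 * b * u)) (hb : b' * w = b * t ^ 2)
    (hc : c' * w = t * (b * s + c)) : (filiform a b c).Isomorphic (filiform a' b' c') := by
  let M : Matrix (Fin 4) (Fin 4) F :=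
    !![1, 0, 0, 0; s, t, 0, 0; 0, u, t, 0; 0, 0, a * t * s + b * u * s + c * u, w]
  have hM : IsUnit M := by
    have htri : M.IsLowerTriangular := fun i j hij => by
      fin_cases i <;> fin_cases j <;> first | rfl | exact absurd hij (by decide)
    simp [isUnit_iff_isUnit_det, det_of_isLowerTriangular M htri, Fin.prod_univ_four, M, ht, hw]
  let φ := LinearEquiv.ofInjectiveEndo M.mulVecLin (mulVec_injective_of_isUnit hM)
  have hφ : ∀ x, φ x = M *ᵥ x := fun _ => rfl
  refine .symm ⟨φ, fun x y z => ?_⟩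
  simp only [hφ, filiform_bracket]
  ext i
  fin_cases i <;> simp [M, mulVec, dotProduct, Fin.sum_univ_four, -mul_eq_mul_right_iff]
  · ring
  · linear_combination (x 0 * y 1 - x 1 * y 0) * z 1 * ha +
      ((x 0 * y 1 - x 1 * y 0) * z 2 + (x 0 * y 2 - x 2 * y 0) * z 1) * hb +
      (x 0 * y 2 - x 2 * y 0) * z 0 * hc

theorem exists_label_filiform (h2 : (2 : F) ≠ 0) (a b c : F) :
    ∃ l : Label F, (filiform a b c).Isomorphic l.system := by
  rcases eq_or_ne b 0 with rfl | hb
  · rcases eq_or_ne a 0 with rfl | ha <;> rcases eq_or_ne c 0 with rfl | hc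
    · exact ⟨.t2, by rw [Label.system, T42_eq_filiform]; exact .refl _⟩
    · refine ⟨.t9, ?_⟩
      rw [Label.system, T49_eq_filiform]
      exact filiform_isomorphic_filiform 0 0 one_ne_zero hc (by ring) (by ring) (by ring)
    · refine ⟨.t3, ?_⟩
      rw [Label.system, T43_eq_filiform]
      exact filiform_isomorphic_filiform 0 0 one_ne_zero ha (by ring) (by ring) (by ring)
    · refine ⟨.t8, ?_⟩
      rw [Label.system, T48_eq_filiform]
      exact filiform_isomorphic_filiform (t := c / a) (w := c * (c / a)) 0 0 (div_ne_zero hc ha)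
        (mul_ne_zero hc (div_ne_zero hc ha)) (by field_simp; ring) (by ring) (by ring)
  · refine ⟨.t7, ?_⟩
    rw [Label.system, T47_eq_filiform]
    exact filiform_isomorphic_filiform (-c / b) (-a / (2 * b)) one_ne_zero hb
      (by field_simp; ring) (by ring) (by field_simp; ring)

theorem bracket_bracket_eq_zero (S : LieTripleSystem F T) {x y : T}
    (hy : ∀ p q, S.bracket (S.bracket x y y) p q = 0) (z : T) :
    S.bracket (S.bracket x y x) y z = 0 := by
  have h := S.derivation x y x y z
  rw [S.bracket_middle_eq_zero hy, add_zero] at h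
  exact left_eq_add.mp ((add_comm _ _).trans h.symm).symm

theorem bracket_self_right_eq_zero (h2 : (2 : F) ≠ 0) (S : LieTripleSystem F T) {x y w : T}
    (hxy : S.bracket x y x = w) (hw : ∀ u v p q, S.bracket (S.bracket w u v) p q = 0) :
    S.bracket x w w = 0 := by
  have hmid : ∀ u v p q, S.bracket (S.bracket u w v) p q = 0 := fun u v p q => by
    simp [S.bracket_swap u w, hw]
  have hlast : ∀ u v p q, S.bracket (S.bracket u v w) p q = 0 := fun u v p q => by
    simp [S.bracket_eq_sub u v w, hmid]
  have h := S.derivation x y x w x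
  rw [S.bracket_last_eq_zero (hmid x x), S.bracket_middle_eq_zero (hlast x y), hxy,
    S.bracket_self h2, add_zero, zero_add] at h
  exact h.symm

end Filiform

end LieTripleSystem

namespace LieTripleSystem

section Classification

variable {F T : Type*} [Field F] [AddCommGroup T] [Module F T] {S : LieTripleSystem F T}

theorem exists_isomorphic_filiform (h2 : (2 : F) ≠ 0) (e : Basis (Fin 4) F T)
    (hc : ∀ x y, S.bracket (e 3) x y = 0)
    (hc2 : ∀ x y, S.bracket (e 2) x y ∈ Submodule.span F {e 3})
    (h010 : S.bracket (e 0) (e 1) (e 0) = e 2)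
    (h011 : S.bracket (e 0) (e 1) (e 1) ∈ Submodule.span F {e 3}) :
    ∃ a b c : F, S.Isomorphic (filiform a b c) := by
  have hcentral : ∀ {w}, w ∈ Submodule.span F {e 3} → ∀ x y, S.bracket w x y = 0 :=
    fun hw x y => by
      obtain ⟨r, rfl⟩ := Submodule.mem_span_singleton.mp hw
      simp [hc]
  have h12 : ∀ z, S.bracket (e 1) (e 2) z = 0 := fun z => by
    rw [S.bracket_swap, ← h010, S.bracket_bracket_eq_zero (hcentral h011), neg_zero]
  have h022 : S.bracket (e 0) (e 2) (e 2) = 0 :=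
    bracket_self_right_eq_zero h2 S h010 fun u v => hcentral (hc2 u v)
  obtain ⟨a, ha⟩ := Submodule.mem_span_singleton.mp h011
  obtain ⟨b, hb⟩ := Submodule.mem_span_singleton.mp (hc2 (e 0) (e 1))
  obtain ⟨c, hc'⟩ := Submodule.mem_span_singleton.mp (hc2 (e 0) (e 0))
  have h020 : S.bracket (e 0) (e 2) (e 0) = -c • e 3 := by rw [S.bracket_swap, ← hc', neg_smul]
  have h021 : S.bracket (e 0) (e 2) (e 1) = -b • e 3 := by rw [S.bracket_swap, ← hb, neg_smul]
  have h012 : S.bracket (e 0) (e 1) (e 2) = -b • e 3 := by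
    rw [S.bracket_eq_sub, h021, h12, sub_zero]
  have he : ∀ i, e.equivFun (e i) = Pi.single i 1 := fun i => by
    ext t; simp [Pi.single_apply, eq_comm]
  refine ⟨a, -b, -c, isomorphic_of_basis h2 S _ e hc (fun x y => ?_) fun i j k hij => ?_⟩
  · simp [filiform_bracket, funext_iff, Fin.forall_fin_succ]
  · rw [filiform_bracket]
    fin_cases i <;> fin_cases j <;> first | exact absurd hij (by decide) | skip
    all_goals fin_cases k
    all_goals simp [h010, ← ha, h012, h020, h021, h022, h12, he, funext_iff, Fin.forall_fin_succ]

-- Modulo `b 3`, the map `[b 0, b 1, ·]` vanishes at `-q b 0 + p b 1`, which becomes `e 1`.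
theorem exists_basis_adapted_filiform (h2 : (2 : F) ≠ 0) (b : Basis (Fin 4) F T)
    (hc : ∀ x y, S.bracket (b 3) x y = 0)
    (hc2 : ∀ x y, S.bracket (b 2) x y ∈ Submodule.span F {b 3}) {p p' q q' α β : F}
    (hp : S.bracket (b 0) (b 1) (b 0) = p • b 2 + p' • b 3)
    (hq : S.bracket (b 0) (b 1) (b 1) = q • b 2 + q' • b 3) (hpq : α * p + β * q ≠ 0) :
    ∃ e : Basis (Fin 4) F T, e 3 = b 3 ∧ (∀ x y, S.bracket (e 2) x y ∈ Submodule.span F {b 3}) ∧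
      S.bracket (e 0) (e 1) (e 0) = e 2 ∧
      S.bracket (e 0) (e 1) (e 1) ∈ Submodule.span F {b 3} := by
  set Δ := α * p + β * q with hΔ
  let M : Matrix (Fin 4) (Fin 4) F := !![α, -q, 0, 0; β, p, 0, 0; 0, 0, Δ ^ 2, 0;
    0, 0, Δ * (α * p' + β * q'), 1]
  have hdet : M.det = Δ ^ 3 := by
    simp [M, det_succ_row_zero, Fin.sum_univ_succ, Fin.succAbove, hΔ]
    ring
  let e := b.map (toLinearEquiv b M (by simp [hdet, hpq]))
  have he : ∀ j, e j = ∑ i, M i j • b i := toLin_self b b M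
  have he0 : e 0 = α • b 0 + β • b 1 := by simp [he, M, Fin.sum_univ_four]
  have he1 : e 1 = -q • b 0 + p • b 1 := by simp [he, M, Fin.sum_univ_four]
  have he2 : e 2 = Δ ^ 2 • b 2 + (Δ * (α * p' + β * q')) • b 3 := by
    simp [he, M, Fin.sum_univ_four]
  have he01 : ∀ z, S.bracket (e 0) (e 1) z = Δ • S.bracket (b 0) (b 1) z := fun z => by
    simp only [he0, he1, map_add, map_smul, LinearMap.add_apply, LinearMap.smul_apply,
      S.bracket_self h2, S.bracket_swap (b 1) (b 0), hΔ]
    module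
  refine ⟨e, by simp [he, M, Fin.sum_univ_four], fun x y => ?_, ?_, ?_⟩
  · simpa [he2, hc] using Submodule.smul_mem _ _ (hc2 x y)
  · rw [he01, he0, he2, map_add, map_smul, map_smul, hp, hq, hΔ]
    module
  · refine Submodule.mem_span_singleton.mpr ⟨Δ * (p * q' - q * p'), ?_⟩
    rw [he01, he1, map_add, map_smul, map_smul, hp, hq]
    module

theorem exists_isomorphic_matSys_or_filiform (h2 : (2 : F) ≠ 0) (b : Basis (Fin 4) F T)
    (hflag : ∀ i x y, S.bracket (b i) x y ∈ Submodule.span F (b '' Set.Ioi i)) :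
    (∃ (A : Matrix (Fin 3) (Fin 3) F) (hA : A.trace = 0), S.Isomorphic (matSys A hA)) ∨
      ∃ a b c : F, S.Isomorphic (filiform a b c) := by
  have hIoi : Set.Ioi (3 : Fin 4) = ∅ ∧ Set.Ioi (2 : Fin 4) = {3} ∧
      Set.Ioi (1 : Fin 4) = {2, 3} := by
    simp only [Set.ext_iff, Set.mem_Ioi]
    decide
  have hc : ∀ x y, S.bracket (b 3) x y = 0 := by simpa [hIoi] using hflag 3
  have hc2 : ∀ x y, S.bracket (b 2) x y ∈ Submodule.span F {b 3} := by simpa [hIoi] using hflag 2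
  have hc1 : ∀ z, ∃ p p' : F, S.bracket (b 0) (b 1) z = p • b 2 + p' • b 3 := fun z => by
    have h := neg_mem (hflag 1 (b 0) z)
    rw [← S.bracket_swap, hIoi.2.2, Set.image_pair] at h
    obtain ⟨p, p', h⟩ := Submodule.mem_span_pair.mp h
    exact ⟨p, p', h.symm⟩
  obtain ⟨p, p', hp⟩ := hc1 (b 0)
  obtain ⟨q, q', hq⟩ := hc1 (b 1)
  by_cases hpq : p = 0 ∧ q = 0
  · obtain ⟨rfl, rfl⟩ := hpq
    have hmid : ∀ x y, S.bracket x (b 2) y ∈ Submodule.span F {b 3} := fun x y => by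
      rw [S.bracket_swap]
      exact neg_mem (hc2 x y)
    have hlast : ∀ x y, S.bracket x y (b 2) ∈ Submodule.span F {b 3} := fun x y => by
      rw [S.bracket_eq_sub]
      exact sub_mem (hmid x y) (hmid y x)
    refine .inl (exists_isomorphic_matSys h2 S b hc fun i j k hij => ?_)
    have hb3 : ∀ r : F, r • b 3 ∈ Submodule.span F {b 3} := fun r =>
      Submodule.smul_mem _ r (Submodule.mem_span_singleton_self _)
    fin_cases i <;> fin_cases j <;> first | exact absurd hij (by decide) | exact hmid _ _ | skip
    fin_cases k
    · simpa [hp] using hb3 p'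
    · simpa [hq] using hb3 q'
    · exact hlast _ _
  · right
    obtain ⟨α, β, hαβ⟩ : ∃ α β : F, α * p + β * q ≠ 0 := by
      by_contra! h
      exact hpq ⟨by simpa using h 1 0, by simpa using h 0 1⟩
    obtain ⟨e, he3, he2, h010, h011⟩ := exists_basis_adapted_filiform h2 b hc hc2 hp hq hαβ
    rw [← he3] at hc he2 h011
    exact exists_isomorphic_filiform h2 e hc he2 h010 h011

theorem IsNilpotent.exists_label (h2 : (2 : F) ≠ 0) (h3 : (3 : F) ≠ 0)
    (hsplit : ∀ p : Polynomial F, p.natDegree = 3 → p.Splits) (hT : finrank F T = 4)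
    (hS : S.IsNilpotent) : ∃ l : Label F, S.Isomorphic l.system := by
  have : FiniteDimensional F T := FiniteDimensional.of_finrank_pos (by omega)
  obtain ⟨b, hb⟩ := hS.exists_flag_basis hT
  obtain ⟨A, hA, h⟩ | ⟨a, b, c, h⟩ := exists_isomorphic_matSys_or_filiform h2 b hb
  · obtain ⟨l, hl⟩ := exists_label_matSys h3 hA (hsplit _ (charpoly_natDegree_eq_dim A))
    exact ⟨l, h.trans hl⟩
  · obtain ⟨l, hl⟩ := exists_label_filiform h2 a b c
    exact ⟨l, h.trans hl⟩

end Classification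

end LieTripleSystem

namespace LieTripleSystem

section Nilpotency

variable {F T : Type*} [Field F] [AddCommGroup T] [Module F T]

theorem isNilpotent_of_filtration (S : LieTripleSystem F T) (W : ℕ → Submodule F T)
    (hW0 : W 0 = ⊤) {n : ℕ} (hWn : W n = ⊥)
    (hW : ∀ k, ∀ w ∈ W k, ∀ y z, S.bracket w y z ∈ W (k + 1)) : S.IsNilpotent := by
  have hmid : ∀ k, ∀ w ∈ W k, ∀ y z, S.bracket y w z ∈ W (k + 1) := fun k w hw y z => by
    rw [S.bracket_swap]
    exact neg_mem (hW k w hw y z)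
  have hseries : ∀ k, S.series ⊤ k ≤ W k := fun k => by
    induction k with
    | zero => exact hW0.ge
    | succ k ih =>
      refine sup_le (Submodule.span_le.mpr ?_) (Submodule.span_le.mpr ?_)
      · rintro _ ⟨w, hw, y, -, z, -, rfl⟩
        exact hW k w (ih hw) y z
      · rintro _ ⟨x, -, y, -, w, hw, rfl⟩
        rw [S.bracket_eq_sub]
        exact sub_mem (hmid k w (ih hw) x y) (hmid k w (ih hw) y x)
  exact ⟨n, le_bot_iff.mp (hWn ▸ hseries n)⟩

theorem isNilpotent_of_coordinates {n : ℕ} (S : LieTripleSystem F (Fin n → F))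
    (h : ∀ i w y z, (∀ j < i, w j = 0) → S.bracket w y z i = 0) : S.IsNilpotent := by
  let W : ℕ → Submodule F (Fin n → F) := fun k => Submodule.pi {i | i.val < k} fun _ => ⊥
  have hW : ∀ k w, w ∈ W k ↔ ∀ i : Fin n, i.val < k → w i = 0 := fun k w => by
    simp [W, Submodule.mem_pi]
  refine S.isNilpotent_of_filtration W (n := n) ?_ ?_ fun k w hw y z => (hW _ _).mpr fun i hi => ?_
  · exact (Submodule.eq_top_iff'.mpr fun w => (hW 0 w).mpr fun i hi => (Nat.not_lt_zero i hi).elim)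
  · exact (Submodule.eq_bot_iff _).mpr fun w hw => funext fun i => (hW n w).mp hw i i.isLt
  · exact h i w y z fun j hj => (hW k w).mp hw j (by omega)

theorem matSys_isNilpotent {A : Matrix (Fin 3) (Fin 3) F} (hA : A.trace = 0) :
    (matSys A hA).IsNilpotent := by
  refine isNilpotent_of_coordinates _ fun i w y z hw => ?_
  fin_cases i <;> simp [Fin.forall_fin_succ] at hw <;> simp [matSys_bracket_eq_smul, hw]

theorem filiform_isNilpotent (a b c : F) : (filiform a b c).IsNilpotent := by
  refine isNilpotent_of_coordinates _ fun i w y z hw => ?_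
  fin_cases i <;> simp [Fin.forall_fin_succ] at hw <;> simp [filiform_bracket, hw]

theorem Label.isNilpotent_system (l : Label F) : l.system.IsNilpotent := by
  cases l <;> simp only [Label.system, T41_eq_matSys, T42_eq_filiform, T43_eq_filiform,
    T44_eq_matSys, T45_eq_matSys, T46_eq_matSys, T47_eq_filiform, T48_eq_filiform,
    T49_eq_filiform, matSys_isNilpotent, filiform_isNilpotent]

end Nilpotency

end LieTripleSystem

namespace LieTripleSystem

section Invariants

variable {F T T' : Type*} [Field F] [AddCommGroup T] [Module F T] [AddCommGroup T'] [Module F T']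
  {S : LieTripleSystem F T} {S' : LieTripleSystem F T'}

/-- A system is two-step if all of its products are central. -/
def IsTwoStep (S : LieTripleSystem F T) : Prop :=
  ∀ x y z u v, S.bracket (S.bracket x y z) u v = 0

/-- All products of the system lie on one line. -/
def HasRankLEOne (S : LieTripleSystem F T) : Prop :=
  ∃ w, ∀ x y z, ∃ k : F, S.bracket x y z = k • w

/-- Every derived element `w` defines a symmetric map `(x, y) ↦ [x, w, y]`. -/
def IsDerivedSymm (S : LieTripleSystem F T) : Prop :=
  ∀ x y u v w, S.bracket x (S.bracket u v w) y = S.bracket y (S.bracket u v w) x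

/-- `[x, y, y] = 0` whenever `y` centralizes the derived elements `w`, in the sense that
`[y, w, ·] = 0`. -/
def IsDerivedCentralizerIsotropic (S : LieTripleSystem F T) : Prop :=
  ∀ y, (∀ u v w z, S.bracket y (S.bracket u v w) z = 0) → ∀ x, S.bracket x y y = 0

/-- The system is isomorphic to the one given by a matrix `A` with `A ^ n = 0`. -/
def IsNilpotentMatSys (n : ℕ) (S : LieTripleSystem F T) : Prop :=
  ∃ (A : Matrix (Fin 3) (Fin 3) F) (hA : A.trace = 0), A ^ n = 0 ∧ S.Isomorphic (matSys A hA)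

theorem IsTwoStep.of_isomorphic (h : S.Isomorphic S') (hS : S.IsTwoStep) : S'.IsTwoStep := by
  obtain ⟨φ, hφ⟩ := h.symm
  intro x y z u v
  apply φ.injective
  rw [hφ, hφ, hS, map_zero]

theorem HasRankLEOne.of_isomorphic (h : S.Isomorphic S') (hS : S.HasRankLEOne) :
    S'.HasRankLEOne := by
  obtain ⟨φ, hφ⟩ := h.symm
  obtain ⟨w, hw⟩ := hS
  refine ⟨φ.symm w, fun x y z => ?_⟩
  obtain ⟨k, hk⟩ := hw (φ x) (φ y) (φ z)
  exact ⟨k, φ.injective (by rw [hφ, hk, map_smul, φ.apply_symm_apply])⟩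

theorem IsDerivedSymm.of_isomorphic (h : S.Isomorphic S') (hS : S.IsDerivedSymm) :
    S'.IsDerivedSymm := by
  obtain ⟨φ, hφ⟩ := h.symm
  intro x y u v w
  apply φ.injective
  simp only [hφ]
  exact hS _ _ _ _ _

theorem IsDerivedCentralizerIsotropic.of_isomorphic (h : S.Isomorphic S')
    (hS : S.IsDerivedCentralizerIsotropic) : S'.IsDerivedCentralizerIsotropic := by
  obtain ⟨φ, hφ⟩ := h.symm
  intro y hy x
  apply φ.injective
  rw [hφ, map_zero]
  refine hS (φ y) (fun u v w z => ?_) (φ x)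
  simpa [hφ] using congr_arg φ (hy (φ.symm u) (φ.symm v) (φ.symm w) (φ.symm z))

theorem IsNilpotentMatSys.of_isomorphic {n : ℕ} (h : S.Isomorphic S')
    (hS : S.IsNilpotentMatSys n) : S'.IsNilpotentMatSys n := by
  obtain ⟨A, hA, hn, hi⟩ := hS
  exact ⟨A, hA, hn, h.symm.trans hi⟩

end Invariants

section InvariantsOfModels

variable {F : Type*} [Field F] {A : Matrix (Fin 3) (Fin 3) F} (hA : A.trace = 0) (a b c : F)

theorem matSys_isTwoStep : (matSys A hA).IsTwoStep := fun x y z u v => by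
  simp [matSys_bracket_eq_smul]

theorem matSys_hasRankLEOne : (matSys A hA).HasRankLEOne :=
  ⟨Pi.single (Fin.last 3) 1, fun x y z => ⟨_, matSys_bracket hA x y z⟩⟩

theorem matSys_isDerivedSymm : (matSys A hA).IsDerivedSymm := fun x y u v w => by
  simp [matSys_bracket_eq_smul]

theorem isNilpotentMatSys_iff_of_isomorphic {T : Type*} [AddCommGroup T] [Module F T]
    {S : LieTripleSystem F T} {htr : A.trace = 0} (h : S.Isomorphic (matSys A htr)) (n : ℕ) :
    S.IsNilpotentMatSys n ↔ A ^ n = 0 := by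
  refine ⟨fun ⟨B, hB, hn, hSB⟩ => ?_, fun hn => ⟨A, htr, hn, h⟩⟩
  exact ((matSys_isomorphic_iff hB htr).mp (hSB.symm.trans h)).pow hn

theorem matSys_isNilpotentMatSys_iff (n : ℕ) : (matSys A hA).IsNilpotentMatSys n ↔ A ^ n = 0 :=
  isNilpotentMatSys_iff_of_isomorphic (.refl _) n

theorem filiform_isTwoStep_iff : (filiform a b c).IsTwoStep ↔ b = 0 ∧ c = 0 := by
  refine ⟨fun h => ⟨?_, ?_⟩, ?_⟩
  · simpa [filiform_bracket] using congr_fun (h (Pi.single 0 1) (Pi.single 1 1) (Pi.single 0 1)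
      (Pi.single 0 1) (Pi.single 1 1)) 3
  · simpa [filiform_bracket] using congr_fun (h (Pi.single 0 1) (Pi.single 1 1) (Pi.single 0 1)
      (Pi.single 0 1) (Pi.single 0 1)) 3
  · rintro ⟨rfl, rfl⟩ x y z u v
    ext t
    fin_cases t <;> simp [filiform_bracket]

theorem filiform_hasRankLEOne_iff : (filiform a b c).HasRankLEOne ↔ a = 0 ∧ b = 0 ∧ c = 0 := by
  constructor
  · rintro ⟨w, hw⟩
    have hw2 : w 2 ≠ 0 := fun hw2 => by
      obtain ⟨k, hk⟩ := hw (Pi.single 0 1) (Pi.single 1 1) (Pi.single 0 1)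
      simpa [filiform_bracket, hw2] using congr_fun hk 2
    have hline : ∀ x y z, (filiform a b c).bracket x y z 2 = 0 →
        (filiform a b c).bracket x y z 3 = 0 := fun x y z h => by
      obtain ⟨k, hk⟩ := hw x y z
      rw [hk] at h ⊢
      simp [(mul_eq_zero.mp h).resolve_right hw2]
    refine ⟨?_, ?_, ?_⟩
    · simpa [filiform_bracket] using hline (Pi.single 0 1) (Pi.single 1 1) (Pi.single 1 1)
    · simpa [filiform_bracket] using hline (Pi.single 0 1) (Pi.single 2 1) (Pi.single 1 1)
    · simpa [filiform_bracket] using hline (Pi.single 0 1) (Pi.single 2 1) (Pi.single 0 1)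
  · rintro ⟨rfl, rfl, rfl⟩
    refine ⟨Pi.single 2 1, fun x y z => ⟨(x 0 * y 1 - x 1 * y 0) * z 0, ?_⟩⟩
    ext t
    fin_cases t <;> simp [filiform_bracket]

theorem filiform_isDerivedSymm_iff : (filiform a b c).IsDerivedSymm ↔ b = 0 := by
  constructor
  · intro h
    simpa [filiform_bracket] using congr_fun (h (Pi.single 0 1) (Pi.single 1 1) (Pi.single 0 1)
      (Pi.single 1 1) (Pi.single 0 1)) 3
  · rintro rfl x y u v w
    ext t
    fin_cases t <;> simp [filiform_bracket, -mul_eq_mul_left_iff]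
    ring

theorem filiform_isDerivedCentralizerIsotropic_iff (hc : c ≠ 0) :
    (filiform a 0 c).IsDerivedCentralizerIsotropic ↔ a = 0 := by
  constructor
  · intro h
    have h1 := h (Pi.single 1 1) (fun u v w z => by
      ext t
      fin_cases t <;> simp [filiform_bracket]) (Pi.single 0 1)
    simpa [filiform_bracket] using congr_fun h1 3
  · rintro rfl y hy x
    have hy0 : y 0 = 0 := by
      simpa [filiform_bracket, hc] using
        congr_fun (hy (Pi.single 0 1) (Pi.single 1 1) (Pi.single 0 1) (Pi.single 0 1)) 3
    ext t
    fin_cases t <;> simp [filiform_bracket, hy0]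

theorem not_isNilpotentMatSys_filiform (h : ¬(a = 0 ∧ b = 0 ∧ c = 0)) (n : ℕ) :
    ¬(filiform a b c).IsNilpotentMatSys n := fun ⟨_, hA, _, hi⟩ =>
  h ((filiform_hasRankLEOne_iff a b c).mp (.of_isomorphic hi.symm (matSys_hasRankLEOne hA)))

end InvariantsOfModels

section Separation

variable {F : Type*} [Field F]

/-- The position of a name in the list, counted from one and forgetting the parameter of `t6`. -/
def Label.index : Label F → ℕ
  | .t1 => 1
  | .t2 => 2
  | .t3 => 3
  | .t4 => 4
  | .t5 => 5
  | .t6 _ => 6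
  | .t7 => 7
  | .t8 => 8
  | .t9 => 9

theorem Label.isTwoStep_iff (l : Label F) : l.system.IsTwoStep ↔ l.index ≤ 6 := by
  cases l <;> simp [Label.system, Label.index, T41_eq_matSys, T42_eq_filiform, T43_eq_filiform,
    T44_eq_matSys, T45_eq_matSys, T46_eq_matSys, T47_eq_filiform, T48_eq_filiform,
    T49_eq_filiform, matSys_isTwoStep, filiform_isTwoStep_iff]

theorem Label.hasRankLEOne_iff (l : Label F) :
    l.system.HasRankLEOne ↔ l.index ≠ 3 ∧ l.index ≤ 6 := by
  cases l <;> simp [Label.system, Label.index, T41_eq_matSys, T42_eq_filiform, T43_eq_filiform,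
    T44_eq_matSys, T45_eq_matSys, T46_eq_matSys, T47_eq_filiform, T48_eq_filiform,
    T49_eq_filiform, matSys_hasRankLEOne, filiform_hasRankLEOne_iff]

theorem Label.isDerivedSymm_iff (l : Label F) : l.system.IsDerivedSymm ↔ l.index ≠ 7 := by
  cases l <;> simp [Label.system, Label.index, T41_eq_matSys, T42_eq_filiform, T43_eq_filiform,
    T44_eq_matSys, T45_eq_matSys, T46_eq_matSys, T47_eq_filiform, T48_eq_filiform,
    T49_eq_filiform, matSys_isDerivedSymm, filiform_isDerivedSymm_iff]

theorem Label.isDerivedCentralizerIsotropic_iff {l : Label F} (hl : 8 ≤ l.index) :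
    l.system.IsDerivedCentralizerIsotropic ↔ l.index = 9 := by
  cases l <;> simp [Label.index] at hl <;> simp [Label.system, Label.index, T48_eq_filiform,
    T49_eq_filiform, filiform_isDerivedCentralizerIsotropic_iff]

theorem Label.isNilpotentMatSys_one_iff (l : Label F) :
    l.system.IsNilpotentMatSys 1 ↔ l.index = 1 := by
  cases l <;> simp [Label.system, Label.index, T41_eq_matSys, T43_eq_filiform, T44_eq_matSys,
    T45_eq_matSys, T46_eq_matSys, T47_eq_filiform, T48_eq_filiform, T49_eq_filiform,
    not_isNilpotentMatSys_filiform, matSys_isNilpotentMatSys_iff,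
    isNilpotentMatSys_iff_of_isomorphic T42_isomorphic_matSys, ← Matrix.ext_iff,
    Fin.forall_fin_succ]

theorem Label.isNilpotentMatSys_two_iff (l : Label F) :
    l.system.IsNilpotentMatSys 2 ↔ l.index ≤ 2 := by
  cases l <;> simp [Label.system, Label.index, T41_eq_matSys, T43_eq_filiform, T44_eq_matSys,
    T45_eq_matSys, T46_eq_matSys, T47_eq_filiform, T48_eq_filiform, T49_eq_filiform,
    not_isNilpotentMatSys_filiform, matSys_isNilpotentMatSys_iff,
    isNilpotentMatSys_iff_of_isomorphic T42_isomorphic_matSys, ← Matrix.ext_iff,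
    Fin.forall_fin_succ, sq]

theorem Label.isNilpotentMatSys_three_iff (l : Label F) :
    l.system.IsNilpotentMatSys 3 ↔ l.index = 1 ∨ l.index = 2 ∨ l.index = 4 := by
  cases l <;> simp [Label.system, Label.index, T41_eq_matSys, T43_eq_filiform, T44_eq_matSys,
    T45_eq_matSys, T46_eq_matSys, T47_eq_filiform, T48_eq_filiform, T49_eq_filiform,
    not_isNilpotentMatSys_filiform, matSys_isNilpotentMatSys_iff,
    isNilpotentMatSys_iff_of_isomorphic T42_isomorphic_matSys, ← Matrix.ext_iff,
    Fin.forall_fin_succ, pow_succ]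

theorem Label.isomorphic_T45_iff {l : Label F} (hl : l.index = 5 ∨ l.index = 6) :
    l.system.Isomorphic (T45 F) ↔ l.index = 5 := by
  cases l <;> simp [Label.index] at hl <;>
    simp [Label.system, Label.index, Isomorphic.refl, not_isomorphic_T46_T45]

theorem Label.index_eq_of_isomorphic {l l' : Label F} (h : l.system.Isomorphic l'.system) :
    l.index = l'.index := by
  have htwo : l.index ≤ 6 ↔ l'.index ≤ 6 := by
    rw [← l.isTwoStep_iff, ← l'.isTwoStep_iff]
    exact ⟨.of_isomorphic h, .of_isomorphic h.symm⟩
  have hrank : (l.index ≠ 3 ∧ l.index ≤ 6) ↔ (l'.index ≠ 3 ∧ l'.index ≤ 6) := by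
    rw [← l.hasRankLEOne_iff, ← l'.hasRankLEOne_iff]
    exact ⟨.of_isomorphic h, .of_isomorphic h.symm⟩
  have hsymm : l.index ≠ 7 ↔ l'.index ≠ 7 := by
    rw [← l.isDerivedSymm_iff, ← l'.isDerivedSymm_iff]
    exact ⟨.of_isomorphic h, .of_isomorphic h.symm⟩
  have hiso : 8 ≤ l.index → 8 ≤ l'.index → (l.index = 9 ↔ l'.index = 9) := fun hl hl' => by
    rw [← isDerivedCentralizerIsotropic_iff hl, ← isDerivedCentralizerIsotropic_iff hl']
    exact ⟨.of_isomorphic h, .of_isomorphic h.symm⟩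
  have hpow (n : ℕ) : l.system.IsNilpotentMatSys n ↔ l'.system.IsNilpotentMatSys n :=
    ⟨.of_isomorphic h, .of_isomorphic h.symm⟩
  have hone := hpow 1
  have hsq := hpow 2
  have hcube := hpow 3
  rw [isNilpotentMatSys_one_iff, isNilpotentMatSys_one_iff] at hone
  rw [isNilpotentMatSys_two_iff, isNilpotentMatSys_two_iff] at hsq
  rw [isNilpotentMatSys_three_iff, isNilpotentMatSys_three_iff] at hcube
  have h45 : (l.index = 5 ∨ l.index = 6) → (l'.index = 5 ∨ l'.index = 6) →
      (l.index = 5 ↔ l'.index = 5) := fun hl hl' => by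
    rw [← isomorphic_T45_iff hl, ← isomorphic_T45_iff hl']
    exact ⟨h.symm.trans, h.trans⟩
  have hpos : ∀ l : Label F, 1 ≤ l.index ∧ l.index ≤ 9 := fun l => by
    cases l <;> simp [Label.index]
  have hl := hpos l
  have hl' := hpos l'
  omega

theorem Label.eq_or_exists_t6_of_index_eq {l l' : Label F} (h : l.index = l'.index) :
    l = l' ∨ ∃ α β, l = .t6 α ∧ l' = .t6 β := by
  cases l <;> cases l' <;> simp [Label.index] at h ⊢

theorem Label.isomorphic_iff (l l' : Label F) :
    l.system.Isomorphic l'.system ↔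
      (l = l' ∨ (l = .t6 0 ∧ l' = .t6 (-1)) ∨ (l = .t6 (-1) ∧ l' = .t6 0) ∨
        ∃ α β : F, α ^ 2 + α ≠ 0 ∧ β ^ 2 + β ≠ 0 ∧ xi α = xi β ∧ l = .t6 α ∧ l' = .t6 β) := by
  constructor
  · intro h
    rcases eq_or_exists_t6_of_index_eq (index_eq_of_isomorphic h) with rfl | ⟨α, β, rfl, rfl⟩
    · exact .inl rfl
    · simpa using T46_isomorphic_cases h
  · rintro (rfl | ⟨rfl, rfl⟩ | ⟨rfl, rfl⟩ | ⟨α, β, hα, hβ, h, rfl, rfl⟩)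
    · exact .refl _
    · exact T46_isomorphic_of_add_add_one_eq_zero (by ring)
    · exact T46_isomorphic_of_add_add_one_eq_zero (by ring)
    · exact T46_isomorphic_of_xi_eq hα hβ h

end Separation

end LieTripleSystem

theorem natCast_ne_zero_of_ringChar_ne {R : Type*} [NonAssocRing R] [Nontrivial R] {p : ℕ}
    (hp : p.Prime) (h : ringChar R ≠ p) : (p : R) ≠ 0 := fun h0 =>
  ((Nat.dvd_prime hp).mp (ringChar.dvd h0)).elim CharP.ringChar_ne_one h

theorem mainTheorem4_general (F : Type*) [Field F] :
    ((2 : F) ≠ 0 → (3 : F) ≠ 0 → (∀ p : Polynomial F, p.natDegree = 3 → p.Splits) →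
      ∀ (T : Type*) [AddCommGroup T] [Module F T] (S : LieTripleSystem F T),
        finrank F T = 4 → S.IsNilpotent →
          ∃ l : LieTripleSystem.Label F, S.Isomorphic l.system) ∧
    (∀ l : LieTripleSystem.Label F, l.system.IsNilpotent) ∧
    (∀ l l' : LieTripleSystem.Label F, l.system.Isomorphic l'.system ↔
      (l = l' ∨
        (l = .t6 0 ∧ l' = .t6 (-1)) ∨
        (l = .t6 (-1) ∧ l' = .t6 0) ∨
        ∃ α β : F, α ^ 2 + α ≠ 0 ∧ β ^ 2 + β ≠ 0 ∧
          LieTripleSystem.xi α = LieTripleSystem.xi β ∧ l = .t6 α ∧ l' = .t6 β)) :=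
  ⟨fun h2 h3 hsplit _ _ _ _ hT hS => hS.exists_label h2 h3 hsplit hT,
    fun l => l.isNilpotent_system, LieTripleSystem.Label.isomorphic_iff⟩

theorem mainTheorem4 (F : Type*) [Field F] [IsAlgClosed F]
    (hF2 : ringChar F ≠ 2) (hF3 : ringChar F ≠ 3) :
    -- every four-dimensional nilpotent Lie triple system occurs in the list
    (∀ (T : Type*) [AddCommGroup T] [Module F T] (S : LieTripleSystem F T),
      Module.finrank F T = 4 → S.IsNilpotent →
        ∃ l : LieTripleSystem.Label F, S.Isomorphic l.system) ∧
    -- every member of the list is nilpotent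
    (∀ l : LieTripleSystem.Label F, l.system.IsNilpotent) ∧
    -- the isomorphisms between members of the list
    (∀ l l' : LieTripleSystem.Label F, l.system.Isomorphic l'.system ↔
      (l = l' ∨
        (l = .t6 0 ∧ l' = .t6 (-1)) ∨
        (l = .t6 (-1) ∧ l' = .t6 0) ∨
        ∃ α β : F, α ^ 2 + α ≠ 0 ∧ β ^ 2 + β ≠ 0 ∧
          LieTripleSystem.xi α = LieTripleSystem.xi β ∧ l = .t6 α ∧ l' = .t6 β)) := by
  obtain ⟨hclassify, hnilpotent, hisomorphic⟩ := mainTheorem4_general F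
  have h3 : (3 : F) ≠ 0 := natCast_ne_zero_of_ringChar_ne Nat.prime_three hF3
  exact ⟨hclassify (Ring.two_ne_zero hF2) h3 fun p _ => IsAlgClosed.splits p, hnilpotent,
    hisomorphic⟩
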